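/- Let $X$ be a locally compact Hausdorff space and let $\sigma=(\sigma_1,\dots,\sigma_n)$ be proper continuous maps $X\to X$ with $X=\bigcup_{i=1}^n\sigma_i(X)$. *Covering system.* Let $\tilde X$ be the set of all $(\mathbf i,\mathbf x)\in\{1,\dots,n\}^{\mathbb N}\times X^{\mathbb N}$ with $\sigma_{i_k}(x_{k+1})=x_k$ for all $k\ge 0$, with the subspace topology of the product topology, and define $\tilde\sigma_i:\tilde X\to\tilde X$ by $\tilde\sigma_i(\mathbf i,\mathbf x)=\big((i,i_0,i_1,\dots),(\sigma_i(x_0),x_0,x_1,\dots)\big)$. A set $F\subseteq\tilde X$ is $\tilde\sigma$-bi-invariant if $\tilde\sigma_i(F)\subseteq F$ and $\tilde\sigma_i^{-1}(F)\subseteq F$ for $1\le i\le n$. *Tensor algebra and C\*-envelope.* A row contractive representation of $(\tilde X,\tilde\sigma)$ on a complex Hilbert space $H$ is a pair consisting of a $*$-homomorphism $\pi:\mathrm C_0(\tilde X)\to\mathcal B(H)$ and operators $T_1,\dots,T_n$ on $H$ with $\|[T_1\ \cdots\ T_n]\|\le 1$ and $\pi(f)T_i=T_i\,\pi(f\circ\tilde\sigma_i)$;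 it sends a formal finite sum $\sum_w\mathfrak t_wf_w$ (over words $w$ in $1,\dots,n$, with $f_w\in \mathrm C_0(\tilde X)$) to $\sum_wT_w\pi(f_w)$, where $T_w=T_{i_1}\cdots T_{i_k}$ for $w=i_1\cdots i_k$. The tensor algebra $\mathcal A(\tilde X,\tilde\sigma)$ is the completion of the space of these sums (an algebra under $\mathfrak t_vf\cdot\mathfrak t_wg=\mathfrak t_{vw}(f\circ\tilde\sigma_w)g$) whose matrix norms are the suprema over all row contractive representations. Let $\mathfrak A$ be its C\*-envelope: the C\*-algebra generated by a completely isometric representation $j_0$ such that for every completely isometric representation $j$ there is a surjective $*$-homomorphism $q:\mathrm C^*(j(\mathcal A(\tilde X,\tilde\sigma)))\to\mathfrak A$ with $qj=j_0$. Write $f$ and $\mathfrak t_i$ for the images $\pi(f)$ and $T_i$ under $j_0$. *The algebra $\mathfrak B$ and the endomorphism $\alpha$.* Put $$\mathfrak B=\overline{\operatorname{span}}\{\mathfrak t_uf\mathfrak t_v^*: |u|=|v|,\ f\in \mathrm C_0(\tilde X)\},\qquad V=\tfrac1{\sqrt n}\sum_{i=1}^n\mathfrak t_i,\qquad \alpha(b)=VbV^*\quad(b\in\mathfrak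 B).$$ A closed two-sided ideal $\mathfrak J$ of $\mathfrak B$ is $\alpha$-bi-invariant if $\alpha(\mathfrak J)\subseteq\mathfrak J$ and, for $b\in\mathfrak B$, $\alpha(b)\in\mathfrak J$ implies $b\in\mathfrak J$. **Corollary.** For every $\alpha$-bi-invariant ideal $\mathfrak J$ of $\mathfrak B$ there is a unique closed $\tilde\sigma$-bi-invariant set $F\subseteq\tilde X$ such that $$\mathfrak J\cap \mathrm C_0(\tilde X)=I_F:=\{f\in \mathrm C_0(\tilde X): f|_F=0\},$$ and the map $\mathfrak J\mapsto F$ is a bijection from the $\alpha$-bi-invariant ideals of $\mathfrak B$ onto the closed $\tilde\sigma$-bi-invariant subsets of $\tilde X$. -/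

import Mathlib

universe u

open scoped ZeroAtInfty

/-- A multivariable dynamical system: `n` proper continuous self-maps of `X`
(`IsProperMap` includes continuity). -/
structure MultiSystem (n : ℕ) (X : Type u) [TopologicalSpace X] where
  /-- the maps `σ_1, …, σ_n` -/
  map : Fin n → X → X
  proper : ∀ i, IsProperMap (map i)

theorem tendsto_cocompact_of_isProperMap {X Y : Type*} [TopologicalSpace X] [TopologicalSpace Y]
    {g : X → Y} (hg : IsProperMap g) :
    Filter.Tendsto g (Filter.cocompact X) (Filter.cocompact Y) := by
  refine Filter.hasBasis_cocompact.tendsto_right_iff.2 fun K hK => ?_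
  exact (hg.isCompact_preimage hK).compl_mem_cocompact

namespace MultiSystem

variable {n : ℕ} {X : Type u} [TopologicalSpace X]

/-- `X` is the union of the ranges of the maps. -/
def IsSurjective (S : MultiSystem n X) : Prop :=
  ∀ x : X, ∃ i : Fin n, ∃ y : X, S.map i y = x

/-- `σ_i(A) ⊆ A` and `σ_i⁻¹(A) ⊆ A` for all `i`. -/
def BiInvariant (S : MultiSystem n X) (A : Set X) : Prop :=
  ∀ i : Fin n, S.map i '' A ⊆ A ∧ S.map i ⁻¹' A ⊆ A

/-- The function `f ∘ σ_i` of `C₀(X)`. -/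
noncomputable def pull (S : MultiSystem n X) (i : Fin n) (f : C₀(X, ℂ)) : C₀(X, ℂ) where
  toFun := fun x => f (S.map i x)
  continuous_toFun := f.continuous.comp (S.proper i).continuous
  zero_at_infty' := f.zero_at_infty'.comp (tendsto_cocompact_of_isProperMap (S.proper i))

/-- The infinite tails `(i, x)`, i.e. `σ_{i_k}(x_{k+1}) = x_k` for all `k ≥ 0`,
with the topology of the product `n^ℕ × X^ℕ`. -/
def Tail (S : MultiSystem n X) : Type u :=
  {z : (ℕ → Fin n) × (ℕ → X) // ∀ k, S.map (z.1 k) (z.2 (k + 1)) = z.2 k}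

instance (S : MultiSystem n X) : TopologicalSpace S.Tail :=
  inferInstanceAs (TopologicalSpace
    {z : (ℕ → Fin n) × (ℕ → X) // ∀ k, S.map (z.1 k) (z.2 (k + 1)) = z.2 k})

/-- Put a new term in front of a sequence. -/
def cons {Y : Type*} (a : Y) (s : ℕ → Y) : ℕ → Y
  | 0 => a
  | k + 1 => s k

/-- `(i, x) ↦ ((i, i_0, i_1, …), (σ_i(x_0), x_0, x_1, …))`. -/
def tailMap (S : MultiSystem n X) (i : Fin n) (z : S.Tail) : S.Tail :=
  ⟨(cons i z.1.1, cons (S.map i (z.1.2 0)) z.1.2), by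
    intro k
    cases k with
    | zero => rfl
    | succ k => exact z.2 k⟩

theorem continuous_cons {Y Z : Type*} [TopologicalSpace Y] [TopologicalSpace Z]
    {a : Z → Y} {s : Z → ℕ → Y} (ha : Continuous a) (hs : Continuous s) :
    Continuous fun z => cons (a z) (s z) := by
  refine continuous_pi fun k => ?_
  cases k with
  | zero => exact ha
  | succ k => exact (continuous_apply k).comp hs

theorem isProperMap_tailMap (S : MultiSystem n X) (i : Fin n) : IsProperMap (S.tailMap i) := by
  have hval : Continuous fun z : S.Tail => z.1 := continuous_subtype_val
  have h1 : Continuous fun z : S.Tail => z.1.1 := continuous_fst.comp hval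
  have h2 : Continuous fun z : S.Tail => z.1.2 := continuous_snd.comp hval
  have hc : Continuous (S.tailMap i) :=
    Continuous.subtype_mk ((continuous_cons continuous_const h1).prodMk
      (continuous_cons ((S.proper i).continuous.comp ((continuous_apply 0).comp h2)) h2)) _
  let shift : S.Tail → S.Tail := fun z =>
    ⟨(fun k => z.1.1 (k + 1), fun k => z.1.2 (k + 1)), fun k => z.2 (k + 1)⟩
  have hs : Continuous shift :=
    Continuous.subtype_mk
      ((continuous_pi fun k => (continuous_apply (k + 1)).comp h1).prodMk
        (continuous_pi fun k => (continuous_apply (k + 1)).comp h2)) _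
  have hleft : Function.LeftInverse shift (S.tailMap i) := fun _ => rfl
  have hr : Set.range (S.tailMap i) = {z : S.Tail | z.1.1 0 = i} := by
    ext z
    constructor
    · rintro ⟨y, rfl⟩
      rfl
    · intro hz
      refine ⟨shift z, Subtype.ext (Prod.ext ?_ ?_)⟩
      · funext k
        cases k with
        | zero => exact hz.symm
        | succ k => rfl
      · funext k
        cases k with
        | zero =>
          have hz' : z.1.1 0 = i := hz
          have := z.2 0
          rw [hz'] at this
          exact this
        | succ k => rfl
  have hcl : IsClosed (Set.range (S.tailMap i)) := by
    rw [hr]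
    exact isClosed_singleton.preimage ((continuous_apply 0).comp h1)
  exact (Topology.IsClosedEmbedding.mk (hleft.isEmbedding hs hc) hcl).isProperMap

/-- The covering system `(X̃, σ̃)`. -/
def covering (S : MultiSystem n X) : MultiSystem n S.Tail where
  map := S.tailMap
  proper := S.isProperMap_tailMap

end MultiSystem

/-- The covariance algebra `A_0(X, σ)` as a vector space: `a` is the finite sum `∑_w s_w f_w`
with `f_w = a w`, over words `w` in `{1, …, n}`. -/
abbrev CovAlg (n : ℕ) (X : Type u) [TopologicalSpace X] : Type u :=
  List (Fin n) →₀ C₀(X, ℂ)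

/-- The operator on the Hilbert sum `H^m` given by an `m × m` matrix of operators on `H`. -/
noncomputable def matrixOp {H : Type u} [NormedAddCommGroup H] [InnerProductSpace ℂ H] {m : ℕ}
    (a : Matrix (Fin m) (Fin m) (H →L[ℂ] H)) :
    PiLp 2 (fun _ : Fin m => H) →L[ℂ] PiLp 2 (fun _ : Fin m => H) :=
  (PiLp.continuousLinearEquiv 2 ℂ (fun _ : Fin m => H)).symm.toContinuousLinearMap ∘L
    (ContinuousLinearMap.pi fun i => ∑ j, a i j ∘L ContinuousLinearMap.proj j) ∘L
    (PiLp.continuousLinearEquiv 2 ℂ (fun _ : Fin m => H)).toContinuousLinearMap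

/-- A row contractive representation of the covariance algebra of `(X, σ)` on `H`: a
`*`-representation `π` of `C₀(X)` and a row contraction `[T_1 … T_n]` (the images of
`s_1, …, s_n`) with `π(f) T_i = T_i π(f ∘ σ_i)`. -/
structure RowContractiveRep {n : ℕ} {X : Type u} [TopologicalSpace X] (S : MultiSystem n X)
    (H : Type u) [NormedAddCommGroup H] [InnerProductSpace ℂ H] [CompleteSpace H] where
  π : C₀(X, ℂ) →⋆ₙₐ[ℂ] (H →L[ℂ] H)
  T : Fin n → (H →L[ℂ] H)
  covariant : ∀ (f : C₀(X, ℂ)) (i : Fin n), π f * T i = T i * π (S.pull i f)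
  row_contractive : ∀ h : Fin n → H, ‖∑ i, T i (h i)‖ ^ 2 ≤ ∑ i, ‖h i‖ ^ 2

namespace RowContractiveRep

variable {n : ℕ} {X : Type u} [TopologicalSpace X] {S : MultiSystem n X}
variable {H : Type u} [NormedAddCommGroup H] [InnerProductSpace ℂ H] [CompleteSpace H]

/-- `T_w = T_{i_1} ⋯ T_{i_k}` for the word `w = i_1 ⋯ i_k`. -/
def word (ρ : RowContractiveRep S H) (w : List (Fin n)) : H →L[ℂ] H :=
  (w.map ρ.T).prod

/-- The image `∑_w T_w π(f_w)` of `∑_w s_w f_w`. -/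
noncomputable def eval (ρ : RowContractiveRep S H) (a : CovAlg n X) : H →L[ℂ] H :=
  a.sum fun w f => ρ.word w * ρ.π f

/-- The norm of the image of a matrix over the covariance algebra, as an operator on `H^m`. -/
noncomputable def matrixNorm (ρ : RowContractiveRep S H) {m : ℕ}
    (A : Matrix (Fin m) (Fin m) (CovAlg n X)) : ℝ :=
  ‖matrixOp (A.map ρ.eval)‖

end RowContractiveRep

/-- The matrix norms of the tensor algebra `A(X, σ)`: the supremum over all row contractive
representations. The tensor algebra is the completion of the covariance algebra for them.
(Hilbert spaces in the universe of `X` suffice: they include `ℓ²(X × words)`, on which all the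
orbit representations live.) -/
noncomputable def tensorNorm {n : ℕ} {X : Type u} [TopologicalSpace X] (S : MultiSystem n X)
    {m : ℕ} (A : Matrix (Fin m) (Fin m) (CovAlg n X)) : ℝ :=
  sSup {r : ℝ | ∃ (H : Type u) (_ : NormedAddCommGroup H) (_ : InnerProductSpace ℂ H)
    (_ : CompleteSpace H) (ρ : RowContractiveRep S H), r = ρ.matrixNorm A}

namespace RowContractiveRep

variable {n : ℕ} {X : Type u} [TopologicalSpace X] {S : MultiSystem n X}
variable {H : Type u} [NormedAddCommGroup H] [InnerProductSpace ℂ H] [CompleteSpace H]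

/-- `ρ` is completely isometric on the tensor algebra. -/
def IsCompletelyIsometric (ρ : RowContractiveRep S H) : Prop :=
  ∀ (m : ℕ) (A : Matrix (Fin m) (Fin m) (CovAlg n X)), ρ.matrixNorm A = tensorNorm S A

/-- The C*-algebra generated by the image of the tensor algebra. -/
noncomputable def cstar (ρ : RowContractiveRep S H) : NonUnitalStarSubalgebra ℂ (H →L[ℂ] H) :=
  (NonUnitalStarAlgebra.adjoin ℂ (Set.range ρ.eval)).topologicalClosure

/-- The C*-algebra generated by `ρ` is (with `ρ`) the C*-envelope of the tensor algebra: `ρ` is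
completely isometric, and for each completely isometric representation `ρ'` there is a
surjective `*`-homomorphism `q` from the C*-algebra generated by `ρ'` with `q ∘ ρ' = ρ`. -/
def IsCStarEnvelope (ρ : RowContractiveRep S H) : Prop :=
  ρ.IsCompletelyIsometric ∧
    ∀ (H' : Type u) [NormedAddCommGroup H'] [InnerProductSpace ℂ H'] [CompleteSpace H']
      (ρ' : RowContractiveRep S H'), ρ'.IsCompletelyIsometric →
      ∃ q : ρ'.cstar →⋆ₙₐ[ℂ] ρ.cstar, Function.Surjective q ∧
        ∀ (a : CovAlg n X) (x : ρ'.cstar), (x : H' →L[ℂ] H') = ρ'.eval a →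
          (q x : H →L[ℂ] H) = ρ.eval a

/-- `𝔅`, the closed span of the elements `t_u f t_v*` with `|u| = |v|`. -/
noncomputable def 𝔅 (ρ : RowContractiveRep S H) : Submodule ℂ (H →L[ℂ] H) :=
  (Submodule.span ℂ {b | ∃ (u v : List (Fin n)) (f : C₀(X, ℂ)), u.length = v.length ∧
    b = ρ.word u * ρ.π f * star (ρ.word v)}).topologicalClosure

/-- `V = n^{-1/2} ∑_i t_i`. -/
noncomputable def V (ρ : RowContractiveRep S H) : H →L[ℂ] H :=
  ((Real.sqrt n : ℂ)⁻¹) • ∑ i, ρ.T i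

/-- `α(b) = V b V*`. -/
noncomputable def α (ρ : RowContractiveRep S H) (b : H →L[ℂ] H) : H →L[ℂ] H :=
  ρ.V * b * star ρ.V

/-- Closed two-sided ideals of `𝔅`. -/
structure IsIdeal (ρ : RowContractiveRep S H) (J : Submodule ℂ (H →L[ℂ] H)) : Prop where
  le : J ≤ ρ.𝔅
  closed : IsClosed (J : Set (H →L[ℂ] H))
  mul_left : ∀ b ∈ ρ.𝔅, ∀ a ∈ J, b * a ∈ J
  mul_right : ∀ b ∈ ρ.𝔅, ∀ a ∈ J, a * b ∈ J

/-- `α`-bi-invariant ideals: `α(J) ⊆ J`, and `α(b) ∈ J` implies `b ∈ J` for `b ∈ 𝔅`. -/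
structure IsBiInvariantIdeal (ρ : RowContractiveRep S H) (J : Submodule ℂ (H →L[ℂ] H)) : Prop
    extends ρ.IsIdeal J where
  map_mem : ∀ b ∈ J, ρ.α b ∈ J
  mem_of_map_mem : ∀ b ∈ ρ.𝔅, ρ.α b ∈ J → b ∈ J

end RowContractiveRep

/-! The argument works for any free surjective system on a locally compact Hausdorff space: the maps
are injective and their ranges are disjoint and cover the space. The covering system is one, because
a tail records the last index and the point it came from (`covering_isFree`,
`covering_isSurjective`).

Freeness makes `T_i e_{x,k} = e_{σ_i x, k+1}` a Cuntz family on `ℓ²(X × ℤ)`. Every row contractive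
representation is dominated by this shift representation: after scaling by `r < 1`, a Poisson kernel
writes it as a compression of matrices of functions, and at each point `x` these matrices are
compressions of the shift representation to the orbit of `x` (`matrixNorm_le_shiftRep`). Hence the
shift representation is completely isometric, its C*-algebra maps onto the C*-envelope, and the
envelope inherits the Cuntz relations (`IsCStarEnvelope.isCuntz`).

By these relations the elements `t_u f t_v*` with `|u| = |v| = k` form a matrix algebra over
`C₀(X)`, and `f = ∑ t_i (f ∘ σ_i) t_i*` embeds level `k` in level `k + 1`; `𝔅` is the closure of the
union. A closed ideal `J` is approximated from inside by its intersections with the closed levels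
(`exists_mem_inter_near`), and there it is described by its matrix entries. Bi-invariance under `α`
forces the ideal of entries to be the same at every level (`gen_mem_iff`), so `J` is generated by `J
∩ C₀(X)` (`closedSpan_eq`). This ideal of functions contains `f` exactly when it contains every `f ∘
σ_i`, which by freeness makes its zero set bi-invariant.

Conversely, for closed bi-invariant `F`, the functions vanishing on `F` generate a bi-invariant
ideal. Compressing by `t_w`, where `x = σ_w(y)` with `x, y ∈ F`, shows that this ideal contains no
further functions (`π_mem_closedSpan_iff`). -/

/-! ### Closed ideals of `C₀(X)` and their zero sets. -/

section ZeroAtInfty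

variable {X : Type*} [TopologicalSpace X]

/-- The product of a function vanishing at infinity with a bounded continuous function. -/
noncomputable def ZeroAtInftyContinuousMap.mulBounded (f : C₀(X, ℂ)) (φ : X → ℂ)
    (hφ : Continuous φ) (C : ℝ)
    (hb : ∀ x, ‖φ x‖ ≤ C) : C₀(X, ℂ) where
  toFun x := f x * φ x
  continuous_toFun := f.continuous.mul hφ
  zero_at_infty' := by
    have h : Filter.Tendsto (fun x => ‖f x‖ * C) (Filter.cocompact X) (nhds 0) := by
      simpa using (f.zero_at_infty'.norm).mul_const C
    refine squeeze_zero_norm (fun x => ?_) h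
    rw [norm_mul]
    exact mul_le_mul_of_nonneg_left (hb x) (norm_nonneg _)

theorem ZeroAtInftyContinuousMap.norm_apply_le (f : C₀(X, ℂ)) (x : X) : ‖f x‖ ≤ ‖f‖ :=
  f.toBCF.norm_coe_le_norm x

theorem ZeroAtInftyContinuousMap.norm_le_of_forall {E : Type*} [NormedAddCommGroup E]
    (f : C₀(X, E)) {C : ℝ} (hC : 0 ≤ C) (h : ∀ x, ‖f x‖ ≤ C) : ‖f‖ ≤ C :=
  (BoundedContinuousFunction.norm_le (f := f.toBCF) hC).2 h

theorem ZeroAtInftyContinuousMap.isCompact_le_norm (f : C₀(X, ℂ)) {ε : ℝ} (hε : 0 < ε) :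
    IsCompact {x | ε ≤ ‖f x‖} := by
  have h := f.zero_at_infty'.norm.eventually (Iio_mem_nhds (by simpa using hε : ‖(0 : ℂ)‖ < ε))
  obtain ⟨K, hK, hKs⟩ := Filter.mem_cocompact.1 h
  refine hK.of_isClosed_subset (isClosed_le continuous_const f.continuous.norm) fun x hx => ?_
  by_contra hxK
  have h2 : ‖f x‖ < ε := hKs hxK
  exact absurd h2 (not_lt.2 hx)

theorem ZeroAtInftyContinuousMap.sum_apply {κ : Type*} (t : Finset κ) (f : κ → C₀(X, ℂ)) (x : X) :
    (∑ i ∈ t, f i) x = ∑ i ∈ t, f i x :=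
  map_sum (⟨⟨fun h : C₀(X, ℂ) => h x, rfl⟩, fun _ _ => rfl⟩ : C₀(X, ℂ) →+ ℂ) f t

/-- A closed ideal of `C₀(X)` contains each function vanishing on the common zero set. -/
theorem ZeroAtInftyContinuousMap.mem_of_vanishing (I : Submodule ℂ C₀(X, ℂ))
    (hI : IsClosed (I : Set C₀(X, ℂ))) (hmul : ∀ f, ∀ g ∈ I, f * g ∈ I) (f : C₀(X, ℂ))
    (hf : ∀ x, (∀ g ∈ I, g x = 0) → f x = 0) : f ∈ I := by
  have key : ∀ ε > 0, ∃ h ∈ I, dist f h ≤ ε := by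
    intro ε hε
    have hK := f.isCompact_le_norm hε
    have hx : ∀ x : {x | ε ≤ ‖f x‖}, ∃ g ∈ I, g x.1 ≠ 0 := by
      intro x
      by_contra! hcon
      have h0 := hf x.1 hcon
      have h1 : ε ≤ ‖f x.1‖ := x.2
      rw [h0, norm_zero] at h1
      linarith
    choose g hgI hg using hx
    obtain ⟨t, ht⟩ := hK.elim_finite_subcover (fun x => {y | g x y ≠ 0})
      (fun x => isOpen_ne_fun (g x).continuous continuous_const)
      (fun x hxK => Set.mem_iUnion.2 ⟨⟨x, hxK⟩, hg ⟨x, hxK⟩⟩)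
    -- `G` is a nonnegative element of the ideal, bounded below on the compact set `{ε ≤ ‖f‖}`
    -- because the chosen functions have no common zero there.
    let G : C₀(X, ℂ) := ∑ x ∈ t, star (g x) * g x
    let G' : X → ℝ := fun y => ∑ x ∈ t, ‖g x y‖ ^ 2
    have hG'c : Continuous G' :=
      continuous_finsetSum _ fun x _ => ((g x).continuous.norm.pow 2)
    have hG'0 : ∀ y, 0 ≤ G' y := fun y => Finset.sum_nonneg fun x _ => sq_nonneg _
    have hGG' : ∀ y, G y = (G' y : ℂ) := by
      intro y
      have : G y = ∑ x ∈ t, (star (g x) * g x) y :=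
        ZeroAtInftyContinuousMap.sum_apply _ _ _
      rw [this]
      simp only [G', Complex.ofReal_sum]
      refine Finset.sum_congr rfl fun x _ => ?_
      simp only [ZeroAtInftyContinuousMap.coe_mul, Pi.mul_apply,
        ZeroAtInftyContinuousMap.star_apply,
        Complex.star_def]
      rw [← Complex.normSq_eq_conj_mul_self, Complex.normSq_eq_norm_sq]
    have hGI : G ∈ I := Submodule.sum_mem _ fun x _ => hmul _ _ (hgI x)
    have hpos : ∀ y ∈ {x | ε ≤ ‖f x‖}, 0 < G' y := by
      intro y hy
      obtain ⟨x, hxt, hxy⟩ := Set.mem_iUnion₂.1 (ht hy)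
      refine Finset.sum_pos' (fun x _ => sq_nonneg _) ⟨x, hxt, ?_⟩
      have : 0 < ‖g x y‖ := norm_pos_iff.2 hxy
      positivity
    obtain ⟨c, hc, hcG⟩ : ∃ c > 0, ∀ y ∈ {x | ε ≤ ‖f x‖}, c ≤ G' y := by
      rcases Set.eq_empty_or_nonempty {x | ε ≤ ‖f x‖} with he | hne
      · exact ⟨1, one_pos, fun y hy => by simp [he] at hy⟩
      · obtain ⟨y, hy, hmin⟩ := hK.exists_isMinOn hne hG'c.continuousOn
        exact ⟨G' y, hpos y hy, fun z hz => hmin hz⟩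
    -- The approximant is `f · mG / (1 + mG)`, with error `f / (1 + mG)`. Since `‖f‖ ≤ m c ε`, the
    -- error is at most `ε` on the compact set, where `G ≥ c`; off it, `f` itself is below `ε`.
    obtain ⟨m, hm⟩ := exists_nat_ge (‖f‖ / (c * ε))
    have hden : ∀ y, (0 : ℝ) < 1 + m * G' y := fun y => by
      have := hG'0 y
      positivity
    let φ : X → ℂ := fun y => ((m / (1 + m * G' y) : ℝ) : ℂ)
    have hφc : Continuous φ := Complex.continuous_ofReal.comp
      (continuous_const.div (continuous_const.add (continuous_const.mul hG'c))
        fun y => (hden y).ne')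
    have hφb : ∀ y, ‖φ y‖ ≤ m := by
      intro y
      simp only [φ, Complex.norm_real]
      rw [Real.norm_of_nonneg (div_nonneg (Nat.cast_nonneg _) (hden y).le)]
      refine div_le_self (Nat.cast_nonneg _) ?_
      have := mul_nonneg (Nat.cast_nonneg (α := ℝ) m) (hG'0 y)
      linarith
    refine ⟨f.mulBounded φ hφc m hφb * G, hmul _ _ hGI, ?_⟩
    rw [dist_eq_norm]
    refine ZeroAtInftyContinuousMap.norm_le_of_forall _ hε.le fun y => ?_
    have hval : (f - f.mulBounded φ hφc m hφb * G) y = f y * ((1 / (1 + m * G' y) : ℝ) : ℂ) := by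
      change f y - f y * φ y * G y = _
      rw [hGG']
      simp only [φ]
      rw [mul_assoc, ← Complex.ofReal_mul, ← mul_one_sub, ← Complex.ofReal_one,
        ← Complex.ofReal_sub]
      congr 2
      have := (hden y).ne'
      field_simp
      ring
    rw [hval, norm_mul, Complex.norm_real,
      Real.norm_of_nonneg (one_div_nonneg.2 (hden y).le), mul_one_div, div_le_iff₀ (hden y)]
    by_cases hy : ε ≤ ‖f y‖
    · have h1 := hcG y hy
      have h2 : ‖f‖ ≤ m * (c * ε) := (div_le_iff₀ (by positivity)).1 hm
      have h3 := f.norm_apply_le y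
      have h4 : (m : ℝ) * (c * ε) ≤ m * (G' y * ε) := by gcongr
      nlinarith
    · have := mul_nonneg (mul_nonneg (Nat.cast_nonneg (α := ℝ) m) (hG'0 y)) hε.le
      nlinarith
  have : f ∈ closure (I : Set C₀(X, ℂ)) := by
    rw [Metric.mem_closure_iff]
    intro ε hε
    obtain ⟨h, hhI, hd⟩ := key (ε / 2) (half_pos hε)
    exact ⟨h, hhI, by linarith⟩
  rwa [hI.closure_eq] at this

/-- This takes the place of an approximate unit. The closure is a closed ideal containing `star g *
g`, so `g` vanishes on its common zeros. -/
theorem ZeroAtInftyContinuousMap.mem_closure_range_mul (g : C₀(X, ℂ)) :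
    g ∈ closure (Set.range fun e : C₀(X, ℂ) => e * g) := by
  let I : Submodule ℂ C₀(X, ℂ) := (LinearMap.range (LinearMap.mulRight ℂ g)).topologicalClosure
  have hI : (I : Set C₀(X, ℂ)) = closure (Set.range fun e : C₀(X, ℂ) => e * g) := by
    rw [Submodule.topologicalClosure_coe]
    congr 1
  rw [← hI]
  refine ZeroAtInftyContinuousMap.mem_of_vanishing I
    (Submodule.isClosed_topologicalClosure _) (fun f h hh => ?_) g fun x hx => ?_
  · change f * h ∈ (I : Set C₀(X, ℂ))
    replace hh : h ∈ (I : Set C₀(X, ℂ)) := hh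
    rw [hI] at hh ⊢
    refine map_mem_closure (continuous_const_mul f) hh ?_
    rintro _ ⟨e, rfl⟩
    exact ⟨f * e, mul_assoc _ _ _⟩
  · have h1 : star g * g ∈ I := by
      change _ ∈ (I : Set C₀(X, ℂ))
      rw [hI]
      exact subset_closure ⟨_, rfl⟩
    have h2 := hx _ h1
    simpa using h2

/-- Membership of `φ g` in a closed set may be tested on the products `e g`. -/
theorem ZeroAtInftyContinuousMap.map_mem_of_forall_mul {E : Type*} [TopologicalSpace E]
    {φ : C₀(X, ℂ) → E} (hφ : Continuous φ) {C : Set E} (hC : IsClosed C) (g : C₀(X, ℂ))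
    (h : ∀ e, φ (e * g) ∈ C) : φ g ∈ C := by
  have := map_mem_closure hφ g.mem_closure_range_mul (t := C) (by rintro _ ⟨e, rfl⟩; exact h e)
  rwa [hC.closure_eq] at this

theorem ZeroAtInftyContinuousMap.exists_apply_eq_one [LocallyCompactSpace X] [T2Space X]
    {F : Set X} (hF : IsClosed F) {x : X} (hx : x ∉ F) :
    ∃ f : C₀(X, ℂ), f x = 1 ∧ ∀ y ∈ F, f y = 0 := by
  obtain ⟨f, h1, h0, hc, -⟩ :=
    exists_continuous_one_zero_of_isCompact (isCompact_singleton (x := x))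
    hF (Set.disjoint_singleton_left.2 hx)
  refine ⟨⟨⟨fun y => (f y : ℂ), Complex.continuous_ofReal.comp f.continuous⟩, ?_⟩, ?_, ?_⟩
  · have hc' : HasCompactSupport fun y => (f y : ℂ) :=
      hc.comp_left (g := fun r : ℝ => (r : ℂ)) (by simp)
    exact hc'.is_zero_at_infty
  · change (f x : ℂ) = 1
    rw [h1 rfl]; simp
  · intro y hy
    change (f y : ℂ) = 0
    rw [h0 hy]; simp

end ZeroAtInfty

/-! ### Matrices of functions acting on `H^ι`. -/

section Amplification

open scoped InnerProductSpace Matrix.Norms.L2Operator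

variable {ι : Type*} [Fintype ι]
variable {H : Type*} [NormedAddCommGroup H] [InnerProductSpace ℂ H]

theorem norm_inner_self_eq_sq (x : H) : ‖⟪x, x⟫_ℂ‖ = ‖x‖ ^ 2 := by
  rw [inner_self_eq_norm_sq_to_K]
  simp

/-- The operator on `H^ι` given by a matrix of operators on `H`. -/
noncomputable def blockOp (a : ι → ι → H →L[ℂ] H) :
    PiLp 2 (fun _ : ι => H) →L[ℂ] PiLp 2 (fun _ : ι => H) :=
  (PiLp.continuousLinearEquiv 2 ℂ (fun _ : ι => H)).symm.toContinuousLinearMap ∘L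
    (ContinuousLinearMap.pi fun i => ∑ j, a i j ∘L ContinuousLinearMap.proj j) ∘L
    (PiLp.continuousLinearEquiv 2 ℂ (fun _ : ι => H)).toContinuousLinearMap

theorem blockOp_apply (a : ι → ι → H →L[ℂ] H) (h : PiLp 2 (fun _ : ι => H)) (i : ι) :
    blockOp a h i = ∑ j, a i j (h j) := by
  simp [blockOp]

theorem matrixOp_eq_blockOp {H : Type u} [NormedAddCommGroup H] [InnerProductSpace ℂ H] {m : ℕ}
    (a : Matrix (Fin m) (Fin m) (H →L[ℂ] H)) : matrixOp a = blockOp fun i j => a i j := rfl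

theorem inner_blockOp (a : ι → ι → H →L[ℂ] H) (k h : PiLp 2 (fun _ : ι => H)) :
    ⟪k, blockOp a h⟫_ℂ = ∑ i, ∑ j, ⟪k i, a i j (h j)⟫_ℂ := by
  simp [PiLp.inner_apply, blockOp_apply, inner_sum]

theorem norm_blockOp_le (a : ι → ι → H →L[ℂ] H) {C : ℝ} (hC : 0 ≤ C)
    (h : ∀ k h : PiLp 2 (fun _ : ι => H),
      ‖∑ i, ∑ j, ⟪k i, a i j (h j)⟫_ℂ‖ ≤ C * ‖k‖ * ‖h‖) : ‖blockOp a‖ ≤ C := by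
  refine ContinuousLinearMap.opNorm_le_bound _ hC fun x => ?_
  have h1 := h (blockOp a x) x
  rw [← inner_blockOp, norm_inner_self_eq_sq] at h1
  by_cases h0 : ‖blockOp a x‖ = 0
  · rw [h0]; positivity
  · have : 0 < ‖blockOp a x‖ := lt_of_le_of_ne (norm_nonneg _) (Ne.symm h0)
    nlinarith

variable {X : Type*} [TopologicalSpace X] [CompleteSpace H]

/-- The `p, q` entry of a matrix-valued function. -/
noncomputable def ZeroAtInftyContinuousMap.entry [DecidableEq ι] (M : C₀(X, Matrix ι ι ℂ))
    (p q : ι) : C₀(X, ℂ) where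
  toFun x := M x p q
  continuous_toFun := M.continuous.matrix_elem p q
  zero_at_infty' := by
    have := ((continuous_id.matrix_elem p q).tendsto (0 : Matrix ι ι ℂ)).comp M.zero_at_infty'
    simpa [Function.comp_def] using this

/-- The amplification of a representation of `C₀(X)` to matrix-valued functions. -/
noncomputable def amplification [DecidableEq ι] (π : C₀(X, ℂ) →⋆ₙₐ[ℂ] (H →L[ℂ] H)) :
    C₀(X, Matrix ι ι ℂ) →⋆ₙₐ[ℂ] (PiLp 2 (fun _ : ι => H) →L[ℂ] PiLp 2 (fun _ : ι => H)) where
  toFun M := blockOp fun p q => π (M.entry p q)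
  map_smul' c M := by
    ext h i
    have : ∀ p q, (c • M).entry p q = c • M.entry p q := fun p q => rfl
    simp [blockOp_apply, this, Finset.smul_sum]
  map_zero' := by
    ext h i
    have : ∀ p q, (0 : C₀(X, Matrix ι ι ℂ)).entry p q = 0 := fun p q => rfl
    simp [blockOp_apply, this]
  map_add' M N := by
    ext h i
    have : ∀ p q, (M + N).entry p q = M.entry p q + N.entry p q := fun p q => rfl
    simp [blockOp_apply, this, Finset.sum_add_distrib]
  map_mul' M N := by
    ext h i
    have : ∀ p q, (M * N).entry p q = ∑ r, M.entry p r * N.entry r q := by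
      intro p q
      ext x
      rw [ZeroAtInftyContinuousMap.sum_apply]
      change (M x * N x) p q = _
      rw [Matrix.mul_apply]
      rfl
    simp only [blockOp_apply, this, map_sum, map_mul, mul_apply_eq_comp, _root_.sum_apply]
    rw [Finset.sum_comm]
  map_star' M := by
    rw [ContinuousLinearMap.star_eq_adjoint, ContinuousLinearMap.eq_adjoint_iff]
    intro x y
    have : ∀ p q, (star M).entry p q = star (M.entry q p) := fun p q => rfl
    simp only [PiLp.inner_apply, blockOp_apply, this, map_star, sum_inner, inner_sum]
    rw [Finset.sum_comm]
    refine Finset.sum_congr rfl fun p _ => Finset.sum_congr rfl fun q _ => ?_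
    rw [ContinuousLinearMap.star_eq_adjoint, ContinuousLinearMap.adjoint_inner_left]

theorem Matrix.l2_opNorm_le_of_forall [DecidableEq ι] (A : Matrix ι ι ℂ) {C : ℝ} (hC : 0 ≤ C)
    (h : ∀ a b : EuclideanSpace ℂ ι,
      ‖∑ i, ∑ j, star (a i) * A i j * b j‖ ≤ C * ‖a‖ * ‖b‖) : ‖A‖ ≤ C := by
  rw [Matrix.l2_opNorm_def]
  refine ContinuousLinearMap.opNorm_le_bound _ hC fun x => ?_
  set y := Matrix.toEuclideanLin A x with hy
  have h1 := h y x
  have h2 : ∑ i, ∑ j, star (y i) * A i j * x j = ⟪y, y⟫_ℂ := by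
    rw [PiLp.inner_apply]
    refine Finset.sum_congr rfl fun i _ => ?_
    rw [RCLike.inner_apply]
    have h3 : y i = ∑ j, A i j * x j := rfl
    rw [h3, Finset.sum_mul, ← h3]
    refine Finset.sum_congr rfl fun j _ => ?_
    rw [starRingEnd_apply]
    ring
  rw [h2, norm_inner_self_eq_sq] at h1
  change ‖y‖ ≤ C * ‖x‖
  by_cases h0 : ‖y‖ = 0
  · rw [h0]; positivity
  · have : 0 < ‖y‖ := lt_of_le_of_ne (norm_nonneg _) (Ne.symm h0)
    nlinarith

/-- A pointwise bound for a matrix of functions passes to each representation of `C₀(X)`. -/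
theorem norm_sum_inner_le (π : C₀(X, ℂ) →⋆ₙₐ[ℂ] (H →L[ℂ] H)) (f : ι → ι → C₀(X, ℂ)) {C : ℝ}
    (hC : 0 ≤ C) (hf : ∀ x, ∀ a b : EuclideanSpace ℂ ι,
      ‖∑ i, ∑ j, star (a i) * f i j x * b j‖ ≤ C * ‖a‖ * ‖b‖)
    (k h : PiLp 2 (fun _ : ι => H)) :
    ‖∑ i, ∑ j, ⟪k i, π (f i j) (h j)⟫_ℂ‖ ≤ C * ‖k‖ * ‖h‖ := by
  classical
  let M : C₀(X, Matrix ι ι ℂ) :=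
    { toFun := fun x => Matrix.of fun i j => f i j x
      continuous_toFun := continuous_matrix fun i j => (f i j).continuous
      zero_at_infty' := by
        refine tendsto_pi_nhds.2 fun i => tendsto_pi_nhds.2 fun j => ?_
        exact (f i j).zero_at_infty' }
  have hM : ‖M‖ ≤ C := ZeroAtInftyContinuousMap.norm_le_of_forall _ hC fun x =>
    Matrix.l2_opNorm_le_of_forall _ hC (hf x)
  -- With the supremum of the operator norms, matrix-valued functions form a C*-algebra, so the
  -- amplified `*`-homomorphism is contractive.
  have h1 : ‖amplification (H := H) π M‖ ≤ C :=
    (NonUnitalStarAlgHom.norm_apply_le (amplification (H := H) π) M).trans hM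
  have h2 : amplification (H := H) π M = blockOp fun p q => π (f p q) := rfl
  rw [h2] at h1
  have h3 := inner_blockOp (fun p q => π (f p q)) k h
  rw [← h3]
  calc _ ≤ ‖k‖ * ‖blockOp (fun p q => π (f p q)) h‖ := norm_inner_le_norm _ _
    _ ≤ ‖k‖ * (C * ‖h‖) := by
      gcongr
      exact ContinuousLinearMap.le_of_opNorm_le _ h1 _
    _ = _ := by ring

end Amplification

/-! ### Weighted composition operators on `ℓ²`. -/

section WeightedComposition

open scoped InnerProductSpace

variable {P : Type*}

/-- Injectivity of `φ` means that no coordinate of `ξ` is counted twice. -/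
theorem memℓp_two_weightedComp (c : P → ℂ) (C : ℝ) (hc : ∀ p, ‖c p‖ ≤ C) (φ : P → P)
    (hφ : Function.Injective φ) (ξ : lp (fun _ : P => ℂ) 2) (s : Finset P) :
    ∑ p ∈ s, ‖c p * ξ (φ p)‖ ^ (2 : ENNReal).toReal ≤ (C * ‖ξ‖) ^ (2 : ENNReal).toReal := by
  classical
  have h2 : (2 : ENNReal).toReal = (2 : ℕ) := by simp
  have h := lp.sum_rpow_le_norm_rpow (p := 2) (by simp) ξ (s.image φ)
  rw [Finset.sum_image fun a _ b _ hab => hφ hab] at h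
  simp only [h2, Real.rpow_natCast] at h ⊢
  calc _ ≤ ∑ p ∈ s, C ^ 2 * ‖ξ (φ p)‖ ^ 2 := by
        refine Finset.sum_le_sum fun p _ => ?_
        rw [norm_mul, mul_pow]
        gcongr
        exact hc p
    _ ≤ _ := by
        rw [← Finset.mul_sum, mul_pow]
        gcongr

/-- The operator `ξ ↦ c · (ξ ∘ φ)` on `ℓ²(P)`. -/
noncomputable def weightedComp (c : P → ℂ) (C : ℝ) (hC : 0 ≤ C) (hc : ∀ p, ‖c p‖ ≤ C) (φ : P → P)
    (hφ : Function.Injective φ) : lp (fun _ : P => ℂ) 2 →L[ℂ] lp (fun _ : P => ℂ) 2 :=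
  LinearMap.mkContinuous
    { toFun := fun ξ => ⟨fun p => c p * ξ (φ p),
        memℓp_gen' (memℓp_two_weightedComp c C hc φ hφ ξ)⟩
      map_add' := fun ξ η => by
        refine lp.ext (funext fun p => ?_)
        exact mul_add (c p) (ξ (φ p)) (η (φ p))
      map_smul' := fun a ξ => by
        refine lp.ext (funext fun p => ?_)
        exact mul_left_comm (c p) a (ξ (φ p)) } C fun ξ =>
    lp.norm_le_of_forall_sum_le (by simp) (by positivity) (memℓp_two_weightedComp c C hc φ hφ ξ)

end WeightedComposition

/-! ### Words, freeness and the calculus of `T_w`. -/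

namespace MultiSystem

variable {n : ℕ} {X : Type u} [TopologicalSpace X]

/-- The composition `σ_w = σ_{i_1} ⋯ σ_{i_k}` along a word. -/
def act (S : MultiSystem n X) : List (Fin n) → X → X
  | [], x => x
  | i :: w, x => S.map i (S.act w x)

/-- The function `f ∘ σ_w`. -/
noncomputable def pullWord (S : MultiSystem n X) : List (Fin n) → C₀(X, ℂ) → C₀(X, ℂ)
  | [], f => f
  | i :: w, f => S.pullWord w (S.pull i f)

theorem pullWord_apply (S : MultiSystem n X) (w : List (Fin n)) (f : C₀(X, ℂ)) (x : X) :
    S.pullWord w f x = f (S.act w x) := by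
  induction w generalizing f with
  | nil => rfl
  | cons i w ih => exact ih _

/-- The maps are injective with pairwise disjoint ranges. -/
def IsFree (S : MultiSystem n X) : Prop :=
  ∀ (i j : Fin n) (x y : X), S.map i x = S.map j y → i = j ∧ x = y

/-- Equal lengths are essential: at a fixed point of `σ_i` the words `[i]` and `[]` act alike. The
`ℤ`-coordinate of the shift representation separates different lengths. -/
theorem IsFree.act_inj {S : MultiSystem n X} (hS : S.IsFree) {v w : List (Fin n)} {x y : X}
    (hl : v.length = w.length) (h : S.act v x = S.act w y) : v = w ∧ x = y := by
  induction v generalizing w with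
  | nil =>
    cases w with
    | nil => exact ⟨rfl, h⟩
    | cons j w => simp at hl
  | cons i v ih =>
    cases w with
    | nil => simp at hl
    | cons j w =>
      obtain ⟨rfl, h'⟩ := hS _ _ _ _ h
      obtain ⟨rfl, h''⟩ := ih (by simpa using hl) h'
      exact ⟨rfl, h''⟩

end MultiSystem

namespace RowContractiveRep

open scoped InnerProductSpace

variable {n : ℕ} {X : Type u} [TopologicalSpace X] {S : MultiSystem n X}
variable {H : Type u} [NormedAddCommGroup H] [InnerProductSpace ℂ H] [CompleteSpace H]

@[simp]
theorem word_nil (ρ : RowContractiveRep S H) : ρ.word [] = 1 := rfl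

@[simp]
theorem word_cons (ρ : RowContractiveRep S H) (i : Fin n) (w : List (Fin n)) :
    ρ.word (i :: w) = ρ.T i * ρ.word w := by
  simp [word]

theorem word_append (ρ : RowContractiveRep S H) (v w : List (Fin n)) :
    ρ.word (v ++ w) = ρ.word v * ρ.word w := by
  simp [word]

theorem covariant_word (ρ : RowContractiveRep S H) (f : C₀(X, ℂ)) (w : List (Fin n)) :
    ρ.π f * ρ.word w = ρ.word w * ρ.π (S.pullWord w f) := by
  induction w generalizing f with
  | nil => simp [MultiSystem.pullWord]
  | cons i w ih =>
    rw [word_cons, ← mul_assoc, ρ.covariant, mul_assoc, ih, ← mul_assoc]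
    rfl

theorem eval_single (ρ : RowContractiveRep S H) (w : List (Fin n)) (f : C₀(X, ℂ)) :
    ρ.eval (Finsupp.single w f) = ρ.word w * ρ.π f := by
  simp [eval]

end RowContractiveRep

/-! ### The shift representation on `ℓ²(X × ℤ)`. -/

section ShiftRep

open scoped InnerProductSpace

variable {n : ℕ} {X : Type u} [TopologicalSpace X] {S : MultiSystem n X}

/-- Multiplication by `f` on `ℓ²(X × ℤ)`. -/
noncomputable def shiftMul (f : C₀(X, ℂ)) :
    lp (fun _ : X × ℤ => ℂ) 2 →L[ℂ] lp (fun _ : X × ℤ => ℂ) 2 :=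
  weightedComp (fun p => f p.1) ‖f‖ (norm_nonneg _) (fun p => f.norm_apply_le p.1) id
    Function.injective_id

@[simp]
theorem shiftMul_apply (f : C₀(X, ℂ)) (ξ : lp (fun _ : X × ℤ => ℂ) 2) (p : X × ℤ) :
    shiftMul f ξ p = f p.1 * ξ p := rfl

/-- Multiplication operators as a representation of `C₀(X)` on `ℓ²(X × ℤ)`. -/
noncomputable def shiftMulHom (X : Type u) [TopologicalSpace X] :
    C₀(X, ℂ) →⋆ₙₐ[ℂ] (lp (fun _ : X × ℤ => ℂ) 2 →L[ℂ] lp (fun _ : X × ℤ => ℂ) 2) where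
  toFun := shiftMul
  map_smul' c f := by
    ext ξ p
    exact mul_assoc c (f p.1) (ξ p)
  map_zero' := by
    ext ξ p
    exact zero_mul (ξ p)
  map_add' f g := by
    ext ξ p
    exact add_mul (f p.1) (g p.1) (ξ p)
  map_mul' f g := by
    ext ξ p
    exact mul_assoc (f p.1) (g p.1) (ξ p)
  map_star' f := by
    rw [ContinuousLinearMap.star_eq_adjoint, ContinuousLinearMap.eq_adjoint_iff]
    intro ξ η
    rw [lp.inner_eq_tsum, lp.inner_eq_tsum]
    refine tsum_congr fun p => ?_
    simp [mul_comm, mul_assoc]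

theorem MultiSystem.IsFree.lift_injective (hS : S.IsFree) (i : Fin n) :
    Function.Injective fun p : X × ℤ => (S.map i p.1, p.2 + 1) := by
  rintro ⟨x, k⟩ ⟨y, l⟩ h
  simp only [Prod.mk.injEq] at h
  exact Prod.ext (hS _ _ _ _ h.1).2 (by simpa using h.2)

/-- The backward operator `(R_i ξ)(x, k) = ξ(σ_i x, k + 1)`. -/
noncomputable def backShift (hS : S.IsFree) (i : Fin n) :
    lp (fun _ : X × ℤ => ℂ) 2 →L[ℂ] lp (fun _ : X × ℤ => ℂ) 2 :=
  weightedComp (fun _ => 1) 1 zero_le_one (by simp) (fun p => (S.map i p.1, p.2 + 1))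
    (hS.lift_injective i)

theorem backShift_apply (hS : S.IsFree) (i : Fin n) (ξ : lp (fun _ : X × ℤ => ℂ) 2) (p : X × ℤ) :
    backShift hS i ξ p = ξ (S.map i p.1, p.2 + 1) := one_mul _

-- A coordinate is read off by pairing with a basis vector and moving the adjoint across. By
-- freeness the point `(σ_j x, k + 1)` is reached by the `i`-th lift only if `i = j`, and then only
-- from `(x, k)`.
open Classical in
theorem star_backShift_apply (hS : S.IsFree) (i j : Fin n) (ξ : lp (fun _ : X × ℤ => ℂ) 2)
    (p : X × ℤ) :
    star (backShift hS i) ξ (S.map j p.1, p.2 + 1) = if i = j then ξ p else 0 := by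
  have h1 : star (backShift hS i) ξ (S.map j p.1, p.2 + 1)
      = ⟪lp.single 2 (S.map j p.1, p.2 + 1) (1 : ℂ), star (backShift hS i) ξ⟫_ℂ := by
    rw [lp.inner_single_left]
    simp
  have h2 : backShift hS i (lp.single 2 (S.map j p.1, p.2 + 1) (1 : ℂ))
      = if i = j then lp.single 2 p (1 : ℂ) else 0 := by
    refine lp.ext (funext fun q => ?_)
    rw [backShift_apply, lp.single_apply]
    split_ifs with hij
    · subst hij
      rw [lp.single_apply]
      by_cases hq : q = p
      · subst hq
        simp
      · rw [Pi.single_eq_of_ne hq, Pi.single_eq_of_ne]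
        exact fun h => hq (hS.lift_injective i h)
    · rw [Pi.single_eq_of_ne]
      · rfl
      · intro h
        exact hij (hS _ _ _ _ (congrArg Prod.fst h)).1
  rw [h1, ContinuousLinearMap.star_eq_adjoint, ContinuousLinearMap.adjoint_inner_right, h2]
  split_ifs with hij
  · rw [lp.inner_single_left]
    simp
  · simp

theorem backShift_mul_star (hS : S.IsFree) (i j : Fin n) :
    backShift hS i * star (backShift hS j) = if i = j then 1 else 0 := by
  ext ξ p
  have := star_backShift_apply hS j i ξ p
  rw [mul_apply_eq_comp, backShift_apply, this]
  by_cases h : i = j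
  · simp [h]
  · rw [if_neg h, if_neg (Ne.symm h)]
    rfl

/-- Surjectivity puts every point of `X × ℤ` in the form `(σ_i y, l + 1)`. With `ℕ` in place of `ℤ`,
level `0` would be missed and `∑ T_i T_i*` would not be `1`. -/
theorem lp_ext_of_isSurjective (hsurj : S.IsSurjective) {ξ η : lp (fun _ : X × ℤ => ℂ) 2}
    (h : ∀ (i : Fin n) (p : X × ℤ), ξ (S.map i p.1, p.2 + 1) = η (S.map i p.1, p.2 + 1)) :
    ξ = η := by
  refine lp.ext (funext fun q => ?_)
  obtain ⟨x, k⟩ := q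
  obtain ⟨i, y, rfl⟩ := hsurj x
  have := h i (y, k - 1)
  simpa using this

theorem sum_star_backShift_mul (hS : S.IsFree) (hsurj : S.IsSurjective) :
    ∑ i, star (backShift hS i) * backShift hS i = 1 := by
  ext1 ξ
  refine lp_ext_of_isSurjective hsurj fun j p => ?_
  rw [_root_.sum_apply, lp.coeFn_sum, Finset.sum_apply]
  simp [star_backShift_apply, backShift_apply]

theorem star_backShift_single [DecidableEq (X × ℤ)] (hS : S.IsFree) (hsurj : S.IsSurjective)
    (i : Fin n) (p : X × ℤ) :
    star (backShift hS i) (lp.single 2 p (1 : ℂ)) = lp.single 2 (S.map i p.1, p.2 + 1) (1 : ℂ) := by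
  refine lp_ext_of_isSurjective hsurj fun j q => ?_
  rw [star_backShift_apply, lp.single_apply, lp.single_apply]
  split_ifs with hij
  · subst hij
    by_cases hq : q = p
    · subst hq
      simp
    · rw [Pi.single_eq_of_ne hq, Pi.single_eq_of_ne]
      exact fun h => hq (hS.lift_injective i h)
  · rw [Pi.single_eq_of_ne]
    exact fun h => hij (hS _ _ _ _ (congrArg Prod.fst h)).1.symm

/-- The representation of a free surjective system on `ℓ²(X × ℤ)` by
`T_i e_{x,k} = e_{σ_i x, k + 1}`. -/
noncomputable def shiftRep (hS : S.IsFree) :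
    RowContractiveRep S (lp (fun _ : X × ℤ => ℂ) 2) where
  π := shiftMulHom X
  T i := star (backShift hS i)
  covariant f i := by
    have h : backShift hS i * shiftMulHom X (star f)
        = shiftMulHom X (star (S.pull i f)) * backShift hS i := by
      ext ξ p
      change backShift hS i (shiftMul (star f) ξ) p =
        shiftMul (star (S.pull i f)) (backShift hS i ξ) p
      rw [backShift_apply, shiftMul_apply, shiftMul_apply, backShift_apply]
      rfl
    have h' := congrArg star h
    simpa only [star_mul, map_star, star_star] using h'
  row_contractive h := by
    have hij : ∀ i j, ⟪star (backShift hS i) (h i), star (backShift hS j) (h j)⟫_ℂ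
        = if i = j then ⟪h i, h j⟫_ℂ else 0 := by
      intro i j
      conv_lhs => rw [ContinuousLinearMap.star_eq_adjoint (backShift hS i),
        ContinuousLinearMap.adjoint_inner_left]
      have := congrArg (fun A => A (h j)) (backShift_mul_star hS i j)
      change backShift hS i (star (backShift hS j) (h j)) = _ at this
      rw [this]
      split_ifs <;> simp
    have h1 : ⟪∑ i, star (backShift hS i) (h i), ∑ i, star (backShift hS i) (h i)⟫_ℂ
        = ((∑ i, ‖h i‖ ^ 2 : ℝ) : ℂ) := by
      simp only [sum_inner, inner_sum, hij]
      simp [inner_self_eq_norm_sq_to_K]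
    rw [inner_self_eq_norm_sq_to_K] at h1
    exact le_of_eq (Complex.ofReal_injective (by push_cast at h1 ⊢; exact h1))

end ShiftRep

/-! ### Defect operator and truncated Poisson kernel. -/

section Words

/-- The words of length at most `N`. -/
def wordsUpTo (n : ℕ) : ℕ → Finset (List (Fin n))
  | 0 => {[]}
  | N + 1 => insert [] ((Finset.univ ×ˢ wordsUpTo n N).image fun p => p.1 :: p.2)

theorem mem_wordsUpTo {n N : ℕ} {v : List (Fin n)} : v ∈ wordsUpTo n N ↔ v.length ≤ N := by
  induction N generalizing v with
  | zero => simp [wordsUpTo]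
  | succ N ih =>
    cases v with
    | nil => simp [wordsUpTo]
    | cons i v => simp [wordsUpTo, ih]

theorem sum_wordsUpTo_succ {n N : ℕ} {M : Type*} [AddCommMonoid M] (g : List (Fin n) → M) :
    ∑ v ∈ wordsUpTo n (N + 1), g v = g [] + ∑ i, ∑ v ∈ wordsUpTo n N, g (i :: v) := by
  rw [wordsUpTo, Finset.sum_insert (by simp), Finset.sum_image, Finset.sum_product]
  rintro ⟨i, v⟩ _ ⟨j, w⟩ _ h
  simpa using h

end Words

namespace RowContractiveRep

open scoped InnerProductSpace

variable {n : ℕ} {X : Type u} [TopologicalSpace X] {S : MultiSystem n X}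
variable {H : Type u} [NormedAddCommGroup H] [InnerProductSpace ℂ H] [CompleteSpace H]
variable (ρ : RowContractiveRep S H)

theorem inner_star_left (A : H →L[ℂ] H) (x y : H) : ⟪star A x, y⟫_ℂ = ⟪x, A y⟫_ℂ := by
  rw [ContinuousLinearMap.star_eq_adjoint, ContinuousLinearMap.adjoint_inner_left]

theorem inner_star_right (A : H →L[ℂ] H) (x y : H) : ⟪x, star A y⟫_ℂ = ⟪A x, y⟫_ℂ := by
  rw [ContinuousLinearMap.star_eq_adjoint, ContinuousLinearMap.adjoint_inner_right]

/-- The completely positive map `A ↦ ∑ T_i A T_i*`. -/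
noncomputable def cp (A : H →L[ℂ] H) : H →L[ℂ] H := ∑ i, ρ.T i * A * star (ρ.T i)

theorem inner_cp (A : H →L[ℂ] H) (x y : H) :
    ⟪x, ρ.cp A y⟫_ℂ = ∑ i, ⟪star (ρ.T i) x, A (star (ρ.T i) y)⟫_ℂ := by
  simp only [cp, _root_.sum_apply, inner_sum, mul_apply_eq_comp, inner_star_left]

theorem re_inner_cp_one (h : H) :
    (⟪h, ρ.cp 1 h⟫_ℂ).re = ∑ i, ‖star (ρ.T i) h‖ ^ 2 := by
  rw [inner_cp, Complex.re_sum]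
  refine Finset.sum_congr rfl fun i _ => ?_
  rw [one_apply_eq_self, inner_self_eq_norm_sq_to_K]
  simp [← Complex.ofReal_pow]

/-- The adjoint of a row contraction is a column contraction. The sum `s` equals `⟪h, cp 1 h⟫`, and
Cauchy–Schwarz together with the row bound gives `s² ≤ ‖h‖² s`. -/
theorem sum_norm_star_sq_le (h : H) : ∑ i, ‖star (ρ.T i) h‖ ^ 2 ≤ ‖h‖ ^ 2 := by
  set s := ∑ i, ‖star (ρ.T i) h‖ ^ 2 with hs
  have h0 : 0 ≤ s := Finset.sum_nonneg fun i _ => sq_nonneg _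
  have h1 : s ≤ ‖h‖ * ‖ρ.cp 1 h‖ := by
    rw [hs, ← re_inner_cp_one]
    exact (Complex.re_le_norm _).trans (norm_inner_le_norm _ _)
  have h2 : ‖ρ.cp 1 h‖ ^ 2 ≤ s := by
    have := ρ.row_contractive fun i => star (ρ.T i) h
    simpa [cp, _root_.sum_apply, mul_apply_eq_comp] using this
  have h3 : s ^ 2 ≤ ‖h‖ ^ 2 * s := by
    calc s ^ 2 ≤ (‖h‖ * ‖ρ.cp 1 h‖) ^ 2 := by gcongr
      _ = ‖h‖ ^ 2 * ‖ρ.cp 1 h‖ ^ 2 := by ring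
      _ ≤ _ := by gcongr
  rcases h0.eq_or_lt with h4 | h4
  · rw [← h4]; positivity
  · nlinarith

theorem norm_cp_le (A : H →L[ℂ] H) : ‖ρ.cp A‖ ≤ ‖A‖ := by
  refine ContinuousLinearMap.opNorm_le_bound _ (norm_nonneg _) fun h => ?_
  refine le_of_sq_le_sq ?_ (by positivity)
  calc ‖ρ.cp A h‖ ^ 2 = ‖∑ i, ρ.T i (A (star (ρ.T i) h))‖ ^ 2 := by
        simp [cp, _root_.sum_apply, mul_apply_eq_comp]
    _ ≤ ∑ i, ‖A (star (ρ.T i) h)‖ ^ 2 := ρ.row_contractive _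
    _ ≤ ∑ i, ‖A‖ ^ 2 * ‖star (ρ.T i) h‖ ^ 2 := by
        refine Finset.sum_le_sum fun i _ => ?_
        rw [← mul_pow]
        gcongr
        exact A.le_opNorm _
    _ ≤ (‖A‖ * ‖h‖) ^ 2 := by
        rw [← Finset.mul_sum, mul_pow]
        gcongr
        exact ρ.sum_norm_star_sq_le h

theorem cp_sub (A B : H →L[ℂ] H) : ρ.cp (A - B) = ρ.cp A - ρ.cp B := by
  simp [cp, mul_sub, sub_mul]

theorem re_inner_cp_iterate_nonneg (N : ℕ) (h : H) : 0 ≤ (⟪h, ρ.cp^[N] 1 h⟫_ℂ).re := by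
  induction N generalizing h with
  | zero => exact inner_self_nonneg (𝕜 := ℂ) (x := h)
  | succ N ih =>
    rw [Function.iterate_succ_apply', inner_cp, Complex.re_sum]
    exact Finset.sum_nonneg fun i _ => ih _

/-- Covariance moves `π(f)` past `T_i` as `π(f ∘ σ_i)`, and the adjoint of covariance for `star f`
moves it back past `T_i*`. -/
theorem commute_cp_one (f : C₀(X, ℂ)) : Commute (ρ.cp 1) (ρ.π f) := by
  have h (i : Fin n) : ρ.π f * (ρ.T i * star (ρ.T i)) = ρ.T i * star (ρ.T i) * ρ.π f := by
    have h1 := congrArg star (ρ.covariant (star f) i)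
    have h2 : star (S.pull i (star f)) = S.pull i f := by
      ext x
      exact star_star (f (S.map i x))
    rw [star_mul, star_mul, ← map_star, ← map_star, star_star, h2] at h1
    rw [← mul_assoc, ρ.covariant, mul_assoc, mul_assoc, h1]
  simp only [cp, mul_one, Commute, SemiconjBy, Finset.sum_mul, Finset.mul_sum, h]

theorem one_sub_cp_one_nonneg : 0 ≤ 1 - ρ.cp 1 := by
  rw [ContinuousLinearMap.nonneg_iff_isPositive, ContinuousLinearMap.isPositive_def']
  refine ⟨?_, fun x => ?_⟩
  · simp [IsSelfAdjoint, cp, star_sum]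
  · rw [ContinuousLinearMap.reApplyInnerSelf_apply, inner_re_symm]
    change 0 ≤ (⟪x, (1 - ρ.cp 1) x⟫_ℂ).re
    have h1 := ρ.re_inner_cp_one x
    have h2 := ρ.sum_norm_star_sq_le x
    have h3 : (⟪x, x⟫_ℂ).re = ‖x‖ ^ 2 := by
      rw [inner_self_eq_norm_sq_to_K]
      simp [← Complex.ofReal_pow]
    rw [_root_.sub_apply, inner_sub_right, Complex.sub_re, h1, one_apply_eq_self, h3]
    linarith

/-- The defect operator `(1 - ∑ T_i T_i*)^{1/2}`. -/
noncomputable def defect : H →L[ℂ] H := CFC.sqrt (1 - ρ.cp 1)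

theorem defect_mul_self : ρ.defect * ρ.defect = 1 - ρ.cp 1 :=
  CFC.sqrt_mul_sqrt_self _ ρ.one_sub_cp_one_nonneg

theorem star_defect : star ρ.defect = ρ.defect :=
  (IsSelfAdjoint.of_nonneg (CFC.sqrt_nonneg _)).star_eq

theorem commute_defect (f : C₀(X, ℂ)) : Commute ρ.defect (ρ.π f) :=
  Commute.cfcₙ_nnreal ((Commute.one_left _).sub_left (ρ.commute_cp_one f)) _

/-- The sum telescopes: the words of length `l` contribute `cp^l(1) - cp^{l+1}(1)`. -/
theorem sum_word_defect (N : ℕ) :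
    ∑ v ∈ wordsUpTo n N, ρ.word v * (ρ.defect * ρ.defect) * star (ρ.word v)
      = 1 - ρ.cp^[N + 1] 1 := by
  rw [defect_mul_self]
  induction N with
  | zero => simp [wordsUpTo]
  | succ N ih =>
    have h : ∑ i, ∑ v ∈ wordsUpTo n N,
        ρ.word (i :: v) * (1 - ρ.cp 1) * star (ρ.word (i :: v)) = ρ.cp (1 - ρ.cp^[N + 1] 1) := by
      rw [← ih, cp]
      refine Finset.sum_congr rfl fun i _ => ?_
      rw [Finset.mul_sum, Finset.sum_mul]
      refine Finset.sum_congr rfl fun v _ => ?_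
      simp [mul_assoc]
    rw [sum_wordsUpTo_succ, h, cp_sub, Function.iterate_succ_apply' _ (N + 1)]
    simp

/-- The truncated Poisson kernel `k ↦ (D T_v* k)_v`, with `D` the defect operator, is contractive
since `cp^{N+1}(1)` is nonnegative. -/
theorem sum_norm_defect_sq_le (N : ℕ) (k : H) :
    ∑ v ∈ wordsUpTo n N, ‖ρ.defect (star (ρ.word v) k)‖ ^ 2 ≤ ‖k‖ ^ 2 := by
  have h3 (x : H) : (⟪x, x⟫_ℂ).re = ‖x‖ ^ 2 := by
    rw [inner_self_eq_norm_sq_to_K]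
    simp [← Complex.ofReal_pow]
  have h1 : ∑ v ∈ wordsUpTo n N, ‖ρ.defect (star (ρ.word v) k)‖ ^ 2
      = (⟪k, (1 - ρ.cp^[N + 1] 1) k⟫_ℂ).re := by
    rw [← sum_word_defect, _root_.sum_apply, inner_sum, Complex.re_sum]
    refine Finset.sum_congr rfl fun v _ => ?_
    rw [← h3, mul_apply_eq_comp, mul_apply_eq_comp, mul_apply_eq_comp, ← inner_star_left (ρ.word v),
      ← inner_star_left ρ.defect (star (ρ.word v) k), star_defect]
  rw [h1, _root_.sub_apply, inner_sub_right, Complex.sub_re, one_apply_eq_self, h3]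
  have := ρ.re_inner_cp_iterate_nonneg (N + 1) k
  linarith

theorem eval_apply (a : CovAlg n X) (x : H) :
    ρ.eval a x = ∑ w ∈ a.support, ρ.word w (ρ.π (a w) x) := by
  rw [eval, Finsupp.sum, _root_.sum_apply]
  rfl

/-- Compression of `T_w π(f)` by the Poisson kernel. -/
theorem inner_defect_word (w v : List (Fin n)) (f : C₀(X, ℂ)) (k h : H) :
    ⟪ρ.defect (star (ρ.word (w ++ v)) k), ρ.π (S.pullWord v f) (ρ.defect (star (ρ.word v) h))⟫_ℂ
      = ⟪k, ρ.word w (ρ.π f ((ρ.word v * (ρ.defect * ρ.defect) * star (ρ.word v)) h))⟫_ℂ := by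
  have h1 : ρ.defect * ρ.π (S.pullWord v f) = ρ.π (S.pullWord v f) * ρ.defect :=
    ρ.commute_defect _
  -- The defect commutes with `π`, so `π(f ∘ σ_v)` can be brought next to `T_v` and pulled out on
  -- its left as `π(f)`.
  have h2 : ρ.word (w ++ v) * (ρ.defect * ρ.π (S.pullWord v f) * ρ.defect * star (ρ.word v))
      = ρ.word w * (ρ.π f * (ρ.word v * (ρ.defect * ρ.defect) * star (ρ.word v))) := by
    rw [h1, word_append]
    have := ρ.covariant_word f v
    calc _ = ρ.word w * ((ρ.word v * ρ.π (S.pullWord v f)) * (ρ.defect * ρ.defect)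
          * star (ρ.word v)) := by simp only [mul_assoc]
      _ = _ := by rw [← this]; simp only [mul_assoc]
  have h3 := congrArg (fun A => A h) h2
  simp only [mul_apply_eq_comp] at h3 ⊢
  rw [← star_defect, inner_star_left, inner_star_left, star_defect]
  rw [h3]

end RowContractiveRep

/-! ### The shift representation on a single orbit. -/

section Domination

open scoped InnerProductSpace

variable {n : ℕ} {X : Type u} [TopologicalSpace X] {S : MultiSystem n X}

open Classical in
/-- The unit vector at `(σ_v x, |v|)`. -/
noncomputable def orbitVector (S : MultiSystem n X) (x : X) (v : List (Fin n)) :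
    lp (fun _ : X × ℤ => ℂ) 2 :=
  lp.single 2 (S.act v x, (v.length : ℤ)) (1 : ℂ)

/-- The `ℤ`-coordinate separates words of different lengths and freeness separates words of the same
length, so the orbit of `x` spans a copy of Fock space. -/
theorem inner_orbitVector (hS : S.IsFree) (x : X) (v w : List (Fin n)) :
    ⟪orbitVector S x v, orbitVector S x w⟫_ℂ = if v = w then 1 else 0 := by
  classical
  rw [orbitVector, lp.inner_single_left, orbitVector, lp.single_apply]
  by_cases h : v = w
  · subst h
    simp
  · rw [if_neg h, Pi.single_eq_of_ne, inner_zero_right]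
    intro h'
    simp only [Prod.mk.injEq, Nat.cast_inj] at h'
    exact h (hS.act_inj h'.2 h'.1).1

theorem shiftRep_π_orbitVector (hS : S.IsFree) (f : C₀(X, ℂ)) (x : X) (v : List (Fin n)) :
    (shiftRep hS).π f (orbitVector S x v) = f (S.act v x) • orbitVector S x v := by
  classical
  refine lp.ext (funext fun p => ?_)
  change f p.1 * orbitVector S x v p = f (S.act v x) * orbitVector S x v p
  by_cases h : p = (S.act v x, (v.length : ℤ))
  · rw [h]
  · rw [orbitVector, lp.single_apply, Pi.single_eq_of_ne h, mul_zero, mul_zero]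

theorem shiftRep_word_orbitVector (hS : S.IsFree) (hsurj : S.IsSurjective) (x : X)
    (w v : List (Fin n)) :
    (shiftRep hS).word w (orbitVector S x v) = orbitVector S x (w ++ v) := by
  classical
  induction w with
  | nil => rfl
  | cons i w ih =>
    rw [RowContractiveRep.word_cons, mul_apply_eq_comp, ih]
    change star (backShift hS i) _ = _
    rw [orbitVector, star_backShift_single hS hsurj, orbitVector]
    congr 1

theorem shiftRep_eval_orbitVector (hS : S.IsFree) (hsurj : S.IsSurjective) (a : CovAlg n X) (x : X)
    (v : List (Fin n)) :
    (shiftRep hS).eval a (orbitVector S x v)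
      = ∑ w ∈ a.support, a w (S.act v x) • orbitVector S x (w ++ v) := by
  rw [RowContractiveRep.eval_apply]
  refine Finset.sum_congr rfl fun w _ => ?_
  rw [shiftRep_π_orbitVector, map_smul, shiftRep_word_orbitVector hS hsurj]

/-- The block of functions that represents `A` on words of length at most `M`. -/
noncomputable def fockBlock (S : MultiSystem n X) {m : ℕ} (A : Matrix (Fin m) (Fin m) (CovAlg n X))
    (M : ℕ)
    (p q : Fin m × {v // v ∈ wordsUpTo n M}) : C₀(X, ℂ) :=
  ∑ w ∈ (A p.1 q.1).support, if p.2.1 = w ++ q.2.1 then S.pullWord q.2.1 (A p.1 q.1 w) else 0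

theorem norm_sum_orbitVector (hS : S.IsFree) (x : X) {m M : ℕ}
    (a : EuclideanSpace ℂ (Fin m × {v // v ∈ wordsUpTo n M})) :
    ‖(WithLp.toLp 2 fun i => ∑ v : {v // v ∈ wordsUpTo n M}, a (i, v) • orbitVector S x v.1 :
      PiLp 2 (fun _ : Fin m => lp (fun _ : X × ℤ => ℂ) 2))‖ = ‖a‖ := by
  have hsq : ∀ {E : Type u} [NormedAddCommGroup E] [InnerProductSpace ℂ E] (y : E),
      ((‖y‖ ^ 2 : ℝ) : ℂ) = ⟪y, y⟫_ℂ := by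
    intro E _ _ y
    rw [inner_self_eq_norm_sq_to_K]
    push_cast
    rfl
  refine (sq_eq_sq₀ (norm_nonneg _) (norm_nonneg _)).1 ?_
  rw [PiLp.norm_sq_eq_of_L2, EuclideanSpace.norm_sq_eq, Fintype.sum_prod_type]
  refine Finset.sum_congr rfl fun i _ => Complex.ofReal_injective ?_
  rw [hsq]
  simp only [sum_inner, inner_sum, inner_smul_left, inner_smul_right, inner_orbitVector hS]
  have : ∀ v w : {v // v ∈ wordsUpTo n M}, v.1 = w.1 ↔ v = w := fun v w => Subtype.ext_iff.symm
  simp only [this]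
  simp [Complex.mul_conj, Complex.normSq_eq_norm_sq]

/-- At `x` the block is the matrix of `A`, in the shift representation, compressed to the
orthonormal orbit vectors of `x`. -/
theorem fockBlock_bound (hS : S.IsFree) (hsurj : S.IsSurjective) {m : ℕ}
    (A : Matrix (Fin m) (Fin m) (CovAlg n X))
    (M : ℕ) (x : X) (a b : EuclideanSpace ℂ (Fin m × {v // v ∈ wordsUpTo n M})) :
    ‖∑ p, ∑ q, star (a p) * fockBlock S A M p q x * b q‖
      ≤ (shiftRep hS).matrixNorm A * ‖a‖ * ‖b‖ := by
  rw [← norm_sum_orbitVector hS x a, ← norm_sum_orbitVector hS x b]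
  set k : PiLp 2 (fun _ : Fin m => lp (fun _ : X × ℤ => ℂ) 2) :=
    WithLp.toLp 2 fun i => ∑ v : {v // v ∈ wordsUpTo n M}, a (i, v) • orbitVector S x v.1 with hk
  set h : PiLp 2 (fun _ : Fin m => lp (fun _ : X × ℤ => ℂ) 2) :=
    WithLp.toLp 2 fun i => ∑ v : {v // v ∈ wordsUpTo n M}, b (i, v) • orbitVector S x v.1 with hh
  have key : ∑ p, ∑ q, star (a p) * fockBlock S A M p q x * b q
      = ⟪k, matrixOp (A.map (shiftRep hS).eval) h⟫_ℂ := by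
    rw [matrixOp_eq_blockOp, inner_blockOp, Fintype.sum_prod_type]
    refine Finset.sum_congr rfl fun i _ => ?_
    simp only [Fintype.sum_prod_type]
    rw [Finset.sum_comm]
    refine Finset.sum_congr rfl fun j _ => ?_
    have h1 : k i = ∑ v : {v // v ∈ wordsUpTo n M}, a (i, v) • orbitVector S x v.1 := rfl
    have h2 : h j = ∑ v : {v // v ∈ wordsUpTo n M}, b (j, v) • orbitVector S x v.1 := rfl
    rw [Matrix.map_apply, h1, h2, map_sum, sum_inner]
    refine Finset.sum_congr rfl fun v' _ => ?_
    rw [inner_sum]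
    refine Finset.sum_congr rfl fun v _ => ?_
    rw [map_smul, shiftRep_eval_orbitVector hS hsurj, inner_smul_left, inner_smul_right, inner_sum,
      fockBlock, ZeroAtInftyContinuousMap.sum_apply, mul_right_comm, mul_comm (b (j, v)),
      ← mul_assoc, mul_right_comm]
    simp only [Finset.mul_sum, Finset.sum_mul]
    refine Finset.sum_congr rfl fun w _ => ?_
    rw [inner_smul_right, inner_orbitVector hS]
    split_ifs with h3
    · rw [MultiSystem.pullWord_apply]
      simp [mul_comm]
    · simp
  rw [key]
  calc _ ≤ ‖k‖ * ‖matrixOp (A.map (shiftRep hS).eval) h‖ := norm_inner_le_norm _ _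
    _ ≤ ‖k‖ * (‖matrixOp (A.map (shiftRep hS).eval)‖ * ‖h‖) := by
      gcongr
      exact ContinuousLinearMap.le_opNorm _ _
    _ = _ := by rw [RowContractiveRep.matrixNorm]; ring

end Domination

/-! ### Domination by the shift representation. -/

namespace RowContractiveRep

open scoped InnerProductSpace

variable {n : ℕ} {X : Type u} [TopologicalSpace X] {S : MultiSystem n X}
variable {H : Type u} [NormedAddCommGroup H] [InnerProductSpace ℂ H] [CompleteSpace H]
variable (ρ : RowContractiveRep S H)

theorem exists_length_bound {m : ℕ} (A : Matrix (Fin m) (Fin m) (CovAlg n X)) :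
    ∃ L, ∀ i j, ∀ w ∈ (A i j).support, w.length ≤ L := by
  refine ⟨Finset.univ.sup fun p : Fin m × Fin m => (A p.1 p.2).support.sup List.length,
    fun i j w hw => ?_⟩
  exact (Finset.le_sup (f := List.length) hw).trans
    (Finset.le_sup (f := fun p : Fin m × Fin m => (A p.1 p.2).support.sup List.length)
      (Finset.mem_univ (i, j)))

/-- The right-hand vectors are cut at length `N` but the block reaches `N + L`, so that `w ++ v`
with `|w| ≤ L` and `|v| ≤ N` is still one of its indices. The sum over `v` is then a complete
truncated Poisson sum. -/
theorem sum_inner_fockBlock {m : ℕ} (A : Matrix (Fin m) (Fin m) (CovAlg n X)) (N L : ℕ)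
    (hL : ∀ i j, ∀ w ∈ (A i j).support, w.length ≤ L) (k h : Fin m → H) :
    ∑ p : Fin m × {v // v ∈ wordsUpTo n (N + L)}, ∑ q : Fin m × {v // v ∈ wordsUpTo n (N + L)},
      ⟪ρ.defect (star (ρ.word p.2.1) (k p.1)), ρ.π (fockBlock S A (N + L) p q)
        (if q.2.1 ∈ wordsUpTo n N then ρ.defect (star (ρ.word q.2.1) (h q.1)) else 0)⟫_ℂ
      = ∑ i, ∑ j, ⟪k i, ρ.eval (A i j) ((1 - ρ.cp^[N + 1] 1) (h j))⟫_ℂ := by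
  rw [Fintype.sum_prod_type]
  refine Finset.sum_congr rfl fun i _ => ?_
  simp only [Fintype.sum_prod_type]
  rw [Finset.sum_comm]
  refine Finset.sum_congr rfl fun j _ => ?_
  rw [← ρ.sum_word_defect N, _root_.sum_apply, map_sum, inner_sum, Finset.sum_comm]
  have hsub : wordsUpTo n N ⊆ wordsUpTo n (N + L) := fun v hv =>
    mem_wordsUpTo.2 ((mem_wordsUpTo.1 hv).trans (Nat.le_add_right _ _))
  have hsum : ∀ g : List (Fin n) → ℂ, ∑ v ∈ wordsUpTo n N, g v
      = ∑ v ∈ wordsUpTo n (N + L), if v ∈ wordsUpTo n N then g v else 0 := fun g =>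
    (Finset.sum_congr rfl fun v hv => (if_pos hv).symm).trans
      (Finset.sum_subset hsub fun v _ hv => if_neg hv)
  rw [hsum]
  rw [← Finset.sum_coe_sort (wordsUpTo n (N + L))]
  refine Finset.sum_congr rfl fun v _ => ?_
  by_cases hv : v.1 ∈ wordsUpTo n N
  · simp only [if_pos hv, fockBlock, map_sum, _root_.sum_apply, inner_sum]
    rw [Finset.sum_comm, eval_apply, inner_sum]
    refine Finset.sum_congr rfl fun w hw => ?_
    have hmem : w ++ v.1 ∈ wordsUpTo n (N + L) := by
      rw [mem_wordsUpTo] at hv ⊢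
      have := hL i j w hw
      simp only [List.length_append]
      omega
    rw [Finset.sum_eq_single (⟨w ++ v.1, hmem⟩ : {v // v ∈ wordsUpTo n (N + L)})]
    · rw [if_pos rfl, inner_defect_word]
    · intro v' _ hv'
      rw [if_neg fun h' => hv' (Subtype.ext h')]
      simp
    · simp
  · simp [if_neg hv]

theorem norm_toLp_le {m M : ℕ} (k : PiLp 2 (fun _ : Fin m => H))
    (g : Fin m × {v // v ∈ wordsUpTo n M} → H)
    (hg : ∀ p, ‖g p‖ ≤ ‖ρ.defect (star (ρ.word p.2.1) (k p.1))‖) :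
    ‖(WithLp.toLp 2 g : PiLp 2 (fun _ : Fin m × {v // v ∈ wordsUpTo n M} => H))‖ ≤ ‖k‖ := by
  refine le_of_sq_le_sq ?_ (norm_nonneg _)
  rw [PiLp.norm_sq_eq_of_L2, PiLp.norm_sq_eq_of_L2, Fintype.sum_prod_type]
  refine Finset.sum_le_sum fun i _ => ?_
  refine le_trans ?_ (ρ.sum_norm_defect_sq_le M (k i))
  rw [← Finset.sum_coe_sort (wordsUpTo n M)]
  refine Finset.sum_le_sum fun v _ => ?_
  have := hg (i, v)
  change ‖g (i, v)‖ ^ 2 ≤ _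
  gcongr

theorem poisson_bound (hS : S.IsFree) (hsurj : S.IsSurjective) {m : ℕ}
    (A : Matrix (Fin m) (Fin m) (CovAlg n X)) (N : ℕ) (k h : PiLp 2 (fun _ : Fin m => H)) :
    ‖∑ i, ∑ j, ⟪k i, ρ.eval (A i j) ((1 - ρ.cp^[N + 1] 1) (h j))⟫_ℂ‖
      ≤ (shiftRep hS).matrixNorm A * ‖k‖ * ‖h‖ := by
  obtain ⟨L, hL⟩ := exists_length_bound A
  rw [← ρ.sum_inner_fockBlock A N L hL k h]
  have hC : 0 ≤ (shiftRep hS).matrixNorm A := norm_nonneg _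
  refine (norm_sum_inner_le ρ.π (fockBlock S A (N + L)) hC
    (fockBlock_bound hS hsurj A (N + L))
    (WithLp.toLp 2 fun p => ρ.defect (star (ρ.word p.2.1) (k p.1)))
    (WithLp.toLp 2 fun q => if q.2.1 ∈ wordsUpTo n N then
      ρ.defect (star (ρ.word q.2.1) (h q.1)) else 0)).trans ?_
  gcongr
  · exact ρ.norm_toLp_le k _ fun p => le_rfl
  · refine ρ.norm_toLp_le h _ fun p => ?_
    split_ifs
    · exact le_rfl
    · simp

/-- Here `1 - cp^{N+1}(1)` tends to `1`, and `poisson_bound` becomes a norm bound in the limit. -/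
theorem matrixNorm_le_of_tendsto (hS : S.IsFree) (hsurj : S.IsSurjective) {m : ℕ}
    (A : Matrix (Fin m) (Fin m) (CovAlg n X))
    (hρ : Filter.Tendsto (fun N => ρ.cp^[N] 1) Filter.atTop (nhds 0)) :
    ρ.matrixNorm A ≤ (shiftRep hS).matrixNorm A := by
  refine norm_blockOp_le _ (norm_nonneg _) fun k h => ?_
  have h1 : Filter.Tendsto
      (fun N => ‖∑ i, ∑ j, ⟪k i, ρ.eval (A i j) ((1 - ρ.cp^[N + 1] 1) (h j))⟫_ℂ‖) Filter.atTop
      (nhds ‖∑ i, ∑ j, ⟪k i, ρ.eval (A i j) (((1 : H →L[ℂ] H) - 0) (h j))⟫_ℂ‖) := by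
    refine Filter.Tendsto.norm (tendsto_finsetSum _ fun i _ => tendsto_finsetSum _ fun j _ => ?_)
    refine Filter.Tendsto.inner tendsto_const_nhds ?_
    refine ((ρ.eval (A i j)).continuous.tendsto _).comp ?_
    exact ((ContinuousLinearMap.apply ℂ H (h j)).continuous.tendsto _).comp
      (tendsto_const_nhds.sub (hρ.comp (Filter.tendsto_add_atTop_nat 1)))
  have h2 := le_of_tendsto' h1 fun N => ρ.poisson_bound hS hsurj A N k h
  simpa using h2

/-- The representation with `T_i` replaced by `r T_i`. -/
noncomputable def scale (r : ℝ) (h0 : 0 ≤ r) (h1 : r ≤ 1) : RowContractiveRep S H where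
  π := ρ.π
  T i := (r : ℂ) • ρ.T i
  covariant f i := by rw [mul_smul_comm, ρ.covariant, smul_mul_assoc]
  row_contractive h := by
    have : ∑ i, ((r : ℂ) • ρ.T i) (h i) = (r : ℂ) • ∑ i, ρ.T i (h i) := by
      simp [Finset.smul_sum]
    rw [this, norm_smul, mul_pow, Complex.norm_real, Real.norm_of_nonneg h0]
    have h2 := ρ.row_contractive h
    have h3 : r ^ 2 ≤ 1 := pow_le_one₀ h0 h1
    have h4 : 0 ≤ ‖∑ i, ρ.T i (h i)‖ ^ 2 := sq_nonneg _
    nlinarith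

theorem scale_word (r : ℝ) (h0 : 0 ≤ r) (h1 : r ≤ 1) (w : List (Fin n)) :
    (ρ.scale r h0 h1).word w = ((r : ℂ) ^ w.length) • ρ.word w := by
  induction w with
  | nil => simp
  | cons i w ih =>
    rw [word_cons, ih, word_cons]
    change ((r : ℂ) • ρ.T i) * _ = _
    rw [smul_mul_smul_comm, List.length_cons, pow_succ']

theorem tendsto_scale_cp (r : ℝ) (h0 : 0 ≤ r) (h1 : r < 1) :
    Filter.Tendsto (fun N => (ρ.scale r h0 h1.le).cp^[N] 1) Filter.atTop (nhds 0) := by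
  have hcp : ∀ B, (ρ.scale r h0 h1.le).cp B = ((r : ℂ) ^ 2) • ρ.cp B := by
    intro B
    simp only [cp, scale, star_smul, Finset.smul_sum]
    refine Finset.sum_congr rfl fun i _ => ?_
    have hr : star (r : ℂ) = r := Complex.conj_ofReal r
    rw [hr, mul_smul_comm, smul_mul_assoc, smul_mul_assoc, smul_smul, sq]
  have hb : ∀ N, ‖(ρ.scale r h0 h1.le).cp^[N] 1‖ ≤ (r ^ 2) ^ N * ‖(1 : H →L[ℂ] H)‖ := by
    intro N
    induction N with
    | zero => simp
    | succ N ih =>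
      rw [Function.iterate_succ_apply', hcp, norm_smul, norm_pow, Complex.norm_real,
        Real.norm_of_nonneg h0, pow_succ' (r ^ 2), mul_assoc]
      gcongr
      exact (ρ.norm_cp_le _).trans ih
  refine squeeze_zero_norm hb ?_
  have h2 : r ^ 2 < 1 := pow_lt_one₀ h0 h1 two_ne_zero
  simpa using (tendsto_pow_atTop_nhds_zero_of_lt_one (sq_nonneg r) h2).mul_const ‖(1 : H →L[ℂ] H)‖

/-- Every row contractive representation is dominated by the shift representation. -/
theorem matrixNorm_le_shiftRep (hS : S.IsFree) (hsurj : S.IsSurjective) {m : ℕ}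
    (A : Matrix (Fin m) (Fin m) (CovAlg n X)) :
    ρ.matrixNorm A ≤ (shiftRep hS).matrixNorm A := by
  refine norm_blockOp_le _ (norm_nonneg _) fun k h => ?_
  -- For `r < 1` the iterates of the scaled map are bounded by a multiple of `r^{2N}`, so the
  -- previous case applies; `r` then increases to `1`.
  let r : ℕ → ℝ := fun N => 1 - 1 / ((N : ℝ) + 1)
  have hpos : ∀ N : ℕ, (0 : ℝ) < 1 / ((N : ℝ) + 1) := fun N => Nat.one_div_pos_of_nat
  have hle : ∀ N : ℕ, 1 / ((N : ℝ) + 1) ≤ 1 := fun N => by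
    rw [div_le_one (by positivity)]
    have := Nat.cast_nonneg (α := ℝ) N
    linarith
  have h0 : ∀ N, 0 ≤ r N := fun N => by have := hle N; simp only [r]; linarith
  have h1 : ∀ N, r N < 1 := fun N => by have := hpos N; simp only [r]; linarith
  have hr : Filter.Tendsto (fun N => (r N : ℂ)) Filter.atTop (nhds 1) := by
    have := (tendsto_const_nhds (x := (1 : ℝ))).sub
      (tendsto_one_div_add_atTop_nhds_zero_nat (𝕜 := ℝ))
    rw [sub_zero] at this
    have h2 := (Complex.continuous_ofReal.tendsto 1).comp this
    rwa [Complex.ofReal_one] at h2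
  have hlim : Filter.Tendsto
      (fun N => ‖∑ i, ∑ j, ⟪k i, (ρ.scale (r N) (h0 N) (h1 N).le).eval (A i j) (h j)⟫_ℂ‖)
      Filter.atTop (nhds ‖∑ i, ∑ j, ⟪k i, ρ.eval (A i j) (h j)⟫_ℂ‖) := by
    refine Filter.Tendsto.norm (tendsto_finsetSum _ fun i _ => tendsto_finsetSum _ fun j _ => ?_)
    refine Filter.Tendsto.inner tendsto_const_nhds ?_
    simp only [eval_apply]
    refine tendsto_finsetSum _ fun w _ => ?_
    have h2 : ∀ N, (ρ.scale (r N) (h0 N) (h1 N).le).word w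
        ((ρ.scale (r N) (h0 N) (h1 N).le).π (A i j w) (h j))
        = ((r N : ℂ) ^ w.length) • ρ.word w (ρ.π (A i j w) (h j)) := by
      intro N
      rw [scale_word]
      rfl
    simp only [h2]
    simpa using (hr.pow w.length).smul_const (ρ.word w (ρ.π (A i j w) (h j)))
  refine le_of_tendsto' hlim fun N => ?_
  have h3 := (ρ.scale (r N) (h0 N) (h1 N).le).matrixNorm_le_of_tendsto hS hsurj A
    (ρ.tendsto_scale_cp (r N) (h0 N) (h1 N))
  have h4 := inner_blockOp (fun i j => (ρ.scale (r N) (h0 N) (h1 N).le).eval (A i j)) k h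
  rw [← h4]
  calc _ ≤ ‖k‖ * ‖blockOp (fun i j => (ρ.scale (r N) (h0 N) (h1 N).le).eval (A i j)) h‖ :=
        norm_inner_le_norm _ _
    _ ≤ ‖k‖ * ((shiftRep hS).matrixNorm A * ‖h‖) := by
        gcongr
        exact ContinuousLinearMap.le_of_opNorm_le _ h3 _
    _ = _ := by ring

theorem shiftRep_isCompletelyIsometric (hS : S.IsFree) (hsurj : S.IsSurjective) :
    (shiftRep hS).IsCompletelyIsometric := by
  intro m A
  refine le_antisymm (le_csSup ⟨(shiftRep hS).matrixNorm A, ?_⟩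
    ⟨_, inferInstance, inferInstance, inferInstance, shiftRep hS, rfl⟩)
    (csSup_le ⟨_, _, inferInstance, inferInstance, inferInstance, shiftRep hS, rfl⟩ ?_)
  all_goals
    rintro r ⟨H, _, _, _, ρ, rfl⟩
    exact ρ.matrixNorm_le_shiftRep hS hsurj A

end RowContractiveRep

/-! ### Cuntz relations in the C*-envelope. -/

namespace RowContractiveRep

open scoped InnerProductSpace

variable {n : ℕ} {X : Type u} [TopologicalSpace X] {S : MultiSystem n X}
variable {H : Type u} [NormedAddCommGroup H] [InnerProductSpace ℂ H] [CompleteSpace H]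
variable (ρ : RowContractiveRep S H)

/-- The Cuntz relations, with an isometric representation of `C₀(X)`. -/
structure IsCuntz : Prop where
  -- Some `ρ.π f` is always attached: the representation may be degenerate, and `ρ.T i` itself need
  -- not lie in `ρ.cstar`.
  star_T_mul : ∀ (i j : Fin n) (u : List (Fin n)) (f : C₀(X, ℂ)),
    star (ρ.T i) * (ρ.T j * (ρ.word u * ρ.π f)) = if i = j then ρ.word u * ρ.π f else 0
  sum_eq : ∀ f : C₀(X, ℂ), ∑ i, ρ.T i * ρ.π (S.pull i f) * star (ρ.T i) = ρ.π f
  norm_π : ∀ f : C₀(X, ℂ), ‖ρ.π f‖ = ‖f‖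

theorem re_inner_self_eq_sq {E : Type*} [NormedAddCommGroup E] [InnerProductSpace ℂ E] (x : E) :
    (⟪x, x⟫_ℂ).re = ‖x‖ ^ 2 :=
  inner_self_eq_norm_sq (𝕜 := ℂ) x

theorem eq_of_sq_norm_le {E : Type*} [NormedAddCommGroup E] [InnerProductSpace ℂ E] {x y : E}
    (h : ‖x‖ ^ 2 - 2 * (⟪x, y⟫_ℂ).re + ‖y‖ ^ 2 ≤ 0) : x = y := by
  have h1 : ‖x - y‖ ^ 2 = 0 := le_antisymm ((norm_sub_sq (𝕜 := ℂ) x y).trans_le h) (sq_nonneg _)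
  exact sub_eq_zero.1 (norm_eq_zero.1 (pow_eq_zero_iff two_ne_zero |>.1 h1))

/-- The column `(T_i* T_j x)_i` has norm at most `‖x‖`, and its `j`-th entry is already `x`, which
leaves nothing for the others. -/
theorem star_T_apply_T {j : Fin n} {x : H} (hx : ‖ρ.T j x‖ = ‖x‖) (i : Fin n) :
    star (ρ.T i) (ρ.T j x) = if i = j then x else 0 := by
  have hsum := ρ.sum_norm_star_sq_le (ρ.T j x)
  rw [hx] at hsum
  have hle : ‖star (ρ.T j) (ρ.T j x)‖ ^ 2 ≤ ‖x‖ ^ 2 :=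
    (Finset.single_le_sum (f := fun i => ‖star (ρ.T i) (ρ.T j x)‖ ^ 2) (fun i _ => sq_nonneg _)
      (Finset.mem_univ j)).trans hsum
  have hj : star (ρ.T j) (ρ.T j x) = x := by
    refine eq_of_sq_norm_le ?_
    rw [inner_star_left, re_inner_self_eq_sq, hx]
    linarith
  by_cases hij : i = j
  · subst hij
    rw [if_pos rfl, hj]
  · rw [if_neg hij]
    have h2 : ‖star (ρ.T i) (ρ.T j x)‖ ^ 2 + ‖star (ρ.T j) (ρ.T j x)‖ ^ 2 ≤ ‖x‖ ^ 2 := by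
      rw [← Finset.sum_pair (f := fun i => ‖star (ρ.T i) (ρ.T j x)‖ ^ 2) hij]
      exact (Finset.sum_le_sum_of_subset_of_nonneg (Finset.subset_univ _)
        fun _ _ _ => sq_nonneg _).trans hsum
    rw [hj] at h2
    have h3 : ‖star (ρ.T i) (ρ.T j x)‖ ^ 2 = 0 := le_antisymm (by linarith) (sq_nonneg _)
    exact norm_eq_zero.1 (pow_eq_zero_iff two_ne_zero |>.1 h3)

theorem cp_one_apply {x : H} (hx : (⟪x, ρ.cp 1 x⟫_ℂ).re = ‖x‖ ^ 2) : ρ.cp 1 x = x := by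
  refine (eq_of_sq_norm_le ?_).symm
  rw [hx]
  have h1 : ‖ρ.cp 1 x‖ ^ 2 ≤ ∑ i, ‖star (ρ.T i) x‖ ^ 2 := by
    have := ρ.row_contractive fun i => star (ρ.T i) x
    simpa [cp, _root_.sum_apply, mul_apply_eq_comp] using this
  have h2 := ρ.sum_norm_star_sq_le x
  linarith

theorem eval_mem_cstar (a : CovAlg n X) : ρ.eval a ∈ ρ.cstar :=
  NonUnitalStarSubalgebra.le_topologicalClosure _
    (NonUnitalStarAlgebra.subset_adjoin ℂ _ ⟨a, rfl⟩)

/-- `ρ.eval a` as an element of the generated C*-algebra. -/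
noncomputable def evalCstar (a : CovAlg n X) : ρ.cstar := ⟨ρ.eval a, ρ.eval_mem_cstar a⟩

theorem star_word_mul_word_shiftRep (hS : S.IsFree) (w : List (Fin n)) :
    star ((shiftRep hS).word w) * (shiftRep hS).word w = 1 := by
  induction w with
  | nil => simp
  | cons i w ih =>
    have h : star ((shiftRep hS).T i) * (shiftRep hS).T i = 1 := by
      change star (star (backShift hS i)) * star (backShift hS i) = 1
      rw [star_star, backShift_mul_star, if_pos rfl]
    calc _ = star ((shiftRep hS).word w) * (star ((shiftRep hS).T i) * (shiftRep hS).T i)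
          * (shiftRep hS).word w := by simp only [word_cons, star_mul, mul_assoc]
      _ = 1 := by rw [h, mul_one, ih]

theorem shiftRep_cp_one (hS : S.IsFree) (hsurj : S.IsSurjective) : (shiftRep hS).cp 1 = 1 := by
  rw [cp]
  refine (Finset.sum_congr rfl fun i _ => ?_).trans (sum_star_backShift_mul hS hsurj)
  change star (backShift hS i) * 1 * star (star (backShift hS i)) = _
  rw [star_star, mul_one]

theorem sum_eval_mul_star (f : C₀(X, ℂ)) :
    ∑ i, ρ.eval (Finsupp.single [i] (S.pull i f)) * star (ρ.eval (Finsupp.single [i] (S.pull i f)))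
      = ρ.π f * ρ.cp 1 * star (ρ.π f) := by
  rw [cp, Finset.mul_sum, Finset.sum_mul]
  refine Finset.sum_congr rfl fun i _ => ?_
  rw [eval_single, word_cons, word_nil, mul_one, ← ρ.covariant, star_mul]
  simp only [mul_assoc]

variable {ρ}

/-- Both this representation and the shift representation give the `1 × 1` matrix `(f)` its tensor
norm, and in the latter the basis vector at `x` yields the inner product `f x`. -/
theorem IsCompletelyIsometric.norm_π (hρ : ρ.IsCompletelyIsometric) (hS : S.IsFree)
    (hsurj : S.IsSurjective) (f : C₀(X, ℂ)) : ‖ρ.π f‖ = ‖f‖ := by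
  refine le_antisymm (NonUnitalStarAlgHom.norm_apply_le ρ.π f) ?_
  let A : Matrix (Fin 1) (Fin 1) (CovAlg n X) := fun _ _ => Finsupp.single [] f
  have hA : ∀ i j, A i j = Finsupp.single [] f := fun _ _ => rfl
  have h1 : (shiftRep hS).matrixNorm A = ρ.matrixNorm A :=
    (shiftRep_isCompletelyIsometric hS hsurj 1 A).trans (hρ 1 A).symm
  have h2 : ρ.matrixNorm A ≤ ‖ρ.π f‖ := by
    refine norm_blockOp_le _ (norm_nonneg _) fun k h => ?_
    have hk : ‖k 0‖ ≤ ‖k‖ := PiLp.norm_apply_le k 0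
    have hh : ‖h 0‖ ≤ ‖h‖ := PiLp.norm_apply_le h 0
    simp only [Fin.sum_univ_one, Fin.isValue, Matrix.map_apply, hA, eval_single, word_nil, one_mul]
    calc _ ≤ ‖k 0‖ * ‖ρ.π f (h 0)‖ := norm_inner_le_norm _ _
      _ ≤ ‖k‖ * (‖ρ.π f‖ * ‖h‖) := by
        gcongr
        exact (ContinuousLinearMap.le_opNorm _ _).trans (by gcongr)
      _ = _ := by ring
  refine (ZeroAtInftyContinuousMap.norm_le_of_forall f (norm_nonneg _) fun x => ?_).trans
    (h1.trans_le h2)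
  let ξ : PiLp 2 (fun _ : Fin 1 => lp (fun _ : X × ℤ => ℂ) 2) :=
    WithLp.toLp 2 fun _ => orbitVector S x []
  have hξ : ‖ξ‖ ^ 2 = 1 := by
    have h3 := inner_orbitVector hS x [] []
    rw [if_pos rfl] at h3
    rw [PiLp.norm_sq_eq_of_L2, Fin.sum_univ_one, ← re_inner_self_eq_sq]
    exact congrArg Complex.re h3
  have hξ1 : ‖ξ‖ = 1 := (pow_eq_one_iff_of_nonneg (norm_nonneg _) two_ne_zero).1 hξ
  have h4 : ⟪ξ, matrixOp (A.map (shiftRep hS).eval) ξ⟫_ℂ = f x := by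
    rw [matrixOp_eq_blockOp, inner_blockOp]
    simp only [Fin.sum_univ_one, Fin.isValue, Matrix.map_apply, hA, eval_single, word_nil, one_mul]
    change ⟪orbitVector S x [], (shiftRep hS).π f (orbitVector S x [])⟫_ℂ = _
    rw [shiftRep_π_orbitVector, inner_smul_right, inner_orbitVector hS, if_pos rfl, mul_one]
    rfl
  rw [← h4]
  refine (norm_inner_le_norm _ _).trans ?_
  rw [hξ1, one_mul]
  have h5 := (matrixOp (A.map (shiftRep hS).eval)).le_opNorm ξ
  rwa [hξ1, mul_one] at h5

/-- The quotient map carries over those relations of the shift representation that can be written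
inside its C*-algebra: `(T_w g)* (T_w g) = g* g` and `∑ (T_i (f ∘ σ_i)) (T_i (f ∘ σ_i))* = f f*`.
Row contractivity turns these norm equalities into the relations for `T_i` and `T_i*`. -/
theorem IsCStarEnvelope.isCuntz (hρ : ρ.IsCStarEnvelope) (hS : S.IsFree)
    (hsurj : S.IsSurjective) : ρ.IsCuntz := by
  obtain ⟨q, -, hq⟩ := hρ.2 _ (shiftRep hS) (shiftRep_isCompletelyIsometric hS hsurj)
  have hqe : ∀ a, (q ((shiftRep hS).evalCstar a) : H →L[ℂ] H) = ρ.eval a := fun a => hq a _ rfl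
  have hiso : ∀ (w : List (Fin n)) (g : C₀(X, ℂ)) (h : H),
      ‖ρ.word w (ρ.π g h)‖ = ‖ρ.π g h‖ := by
    intro w g h
    have h1 : star ((shiftRep hS).evalCstar (Finsupp.single w g))
          * (shiftRep hS).evalCstar (Finsupp.single w g)
        = star ((shiftRep hS).evalCstar (Finsupp.single [] g))
          * (shiftRep hS).evalCstar (Finsupp.single [] g) := by
      refine Subtype.ext ?_
      change star ((shiftRep hS).eval _) * (shiftRep hS).eval _
        = star ((shiftRep hS).eval _) * (shiftRep hS).eval _
      rw [eval_single, eval_single, word_nil, one_mul, star_mul]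
      calc _ = star ((shiftRep hS).π g) * (star ((shiftRep hS).word w) * (shiftRep hS).word w)
            * (shiftRep hS).π g := by simp only [mul_assoc]
        _ = _ := by rw [star_word_mul_word_shiftRep, mul_one]
    have h2 := congrArg (fun x => ((q x : ρ.cstar) : H →L[ℂ] H)) h1
    simp only [map_mul, map_star, NonUnitalStarSubalgebra.coe_mul, StarMemClass.coe_star,
      hqe, eval_single, word_nil, one_mul] at h2
    have h3 := congrArg (fun A : H →L[ℂ] H => (⟪h, A h⟫_ℂ).re) h2
    simp only [mul_apply_eq_comp, inner_star_right, re_inner_self_eq_sq] at h3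
    exact (sq_eq_sq₀ (norm_nonneg _) (norm_nonneg _)).1 h3
  have hcp : ∀ f, ρ.π f * ρ.cp 1 * star (ρ.π f) = ρ.π f * star (ρ.π f) := by
    intro f
    have h1 : ∑ i, (shiftRep hS).evalCstar (Finsupp.single [i] (S.pull i f))
          * star ((shiftRep hS).evalCstar (Finsupp.single [i] (S.pull i f)))
        = (shiftRep hS).evalCstar (Finsupp.single [] f)
          * star ((shiftRep hS).evalCstar (Finsupp.single [] f)) := by
      refine Subtype.ext ?_
      rw [AddSubmonoidClass.coe_finsetSum]
      refine ((shiftRep hS).sum_eval_mul_star f).trans ?_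
      rw [shiftRep_cp_one hS hsurj, mul_one]
      change _ = (shiftRep hS).eval _ * star ((shiftRep hS).eval _)
      rw [eval_single, word_nil, one_mul]
    have h2 := congrArg (fun x => ((q x : ρ.cstar) : H →L[ℂ] H)) h1
    simp only [map_sum, AddSubmonoidClass.coe_finsetSum, map_mul, map_star,
      NonUnitalStarSubalgebra.coe_mul, StarMemClass.coe_star, hqe] at h2
    rw [sum_eval_mul_star, eval_single, word_nil, one_mul] at h2
    exact h2
  -- The relation for `star f` says that `cp 1` attains its bound at the vectors `π(f) h`, hence
  -- fixes them.
  have hcp' : ∀ f, ρ.cp 1 * ρ.π f = ρ.π f := by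
    intro f
    ext1 h
    refine ρ.cp_one_apply ?_
    have h2 := congrArg (fun A : H →L[ℂ] H => (⟪h, A h⟫_ℂ).re) (hcp (star f))
    simp only [map_star, star_star, mul_apply_eq_comp, inner_star_right,
      re_inner_self_eq_sq] at h2
    exact h2
  refine ⟨fun i j u f => ?_, fun f => ?_, hρ.1.norm_π hS hsurj⟩
  · ext1 h
    have h1 : ‖ρ.T j (ρ.word u (ρ.π f h))‖ = ‖ρ.word u (ρ.π f h)‖ := by
      rw [hiso u f h, ← hiso (j :: u) f h, word_cons, mul_apply_eq_comp]
    have h2 := ρ.star_T_apply_T h1 i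
    simp only [mul_apply_eq_comp]
    rw [h2]
    split_ifs <;> rfl
  · rw [← hcp' f, ρ.commute_cp_one f, cp, Finset.mul_sum]
    refine Finset.sum_congr rfl fun i _ => ?_
    rw [← ρ.covariant, mul_one, mul_assoc]

end RowContractiveRep

/-! ### Approximation inside the intersection of a subalgebra and an ideal. -/

section Approximation

variable {A : Type*} [CStarAlgebra A]

theorem pow_sub_pow_mem (J : Submodule ℂ A) {c j : A} (hj : j ∈ J)
    (hcl : ∀ a ∈ J, c * a ∈ J) (hcr : ∀ a ∈ J, a * c ∈ J) (hJ : ∀ a ∈ J, ∀ b ∈ J, a * b ∈ J)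
    (m : ℕ) : c ^ m - (c - j) ^ m ∈ J := by
  have h : ∀ m : ℕ, ∀ a ∈ J, a * (c - j) ^ m ∈ J := by
    intro m
    induction m with
    | zero => intro a ha; simpa using ha
    | succ m ih =>
      intro a ha
      rw [pow_succ, ← mul_assoc, mul_sub]
      exact J.sub_mem (hcr _ (ih a ha)) (hJ _ (ih a ha) _ hj)
  induction m with
  | zero => simp
  | succ m ih =>
    have : c ^ (m + 1) - (c - j) ^ (m + 1) = c * (c ^ m - (c - j) ^ m) + j * (c - j) ^ m := by
      rw [pow_succ', pow_succ']
      noncomm_ring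
    rw [this]
    exact J.add_mem (hcl _ ih) (h m j hj)

/-- The function `t ↦ 1 - δ / max(t, δ)`. -/
noncomputable def cutoff (δ t : ℝ) : ℝ := 1 - δ / max t δ

theorem continuous_cutoff {δ : ℝ} (hδ : 0 < δ) : Continuous (cutoff δ) :=
  continuous_const.sub (continuous_const.div (continuous_id.max continuous_const)
    fun _ => (lt_max_of_lt_right hδ).ne')

theorem cutoff_of_le {δ t : ℝ} (hδ : 0 < δ) (ht : t ≤ δ) : cutoff δ t = 0 := by
  rw [cutoff, max_eq_right ht, div_self hδ.ne', sub_self]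

theorem abs_cutoff_le {δ : ℝ} (hδ : 0 < δ) (t : ℝ) : |cutoff δ t| ≤ 1 := by
  have h1 : 0 < max t δ := lt_max_of_lt_right hδ
  have h2 : δ / max t δ ≤ 1 := (div_le_one h1).2 (le_max_right _ _)
  have h3 : 0 ≤ δ / max t δ := by positivity
  rw [cutoff, abs_le]
  constructor <;> linarith

/-- An element of a closed star subalgebra that is close to a closed ideal `J` is close to the
intersection of the subalgebra with `J`. -/
theorem exists_mem_inter_near (B : NonUnitalStarSubalgebra ℂ A) (hB : IsClosed (B : Set A))
    (J : Submodule ℂ A) (hJc : IsClosed (J : Set A)) (hl : ∀ b ∈ B, ∀ a ∈ J, b * a ∈ J)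
    (hr : ∀ b ∈ B, ∀ a ∈ J, a * b ∈ J) (hJ : ∀ a ∈ J, ∀ b ∈ J, a * b ∈ J) {a b : A}
    (ha : a ∈ B) (hb : b ∈ J) {δ : ℝ} (hδ : ‖a‖ * ‖a - b‖ < δ) :
    ∃ b' ∈ J, b' ∈ B ∧ ‖a - b'‖ ^ 2 ≤ δ := by
  have hδ0 : 0 < δ := lt_of_le_of_lt (by positivity) hδ
  set c : A := star a * a with hc
  have hcB : c ∈ B := mul_mem (star_mem ha) ha
  have hcsa : IsSelfAdjoint c := IsSelfAdjoint.star_mul_self a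
  set j : A := star a * b with hj
  have hjJ : j ∈ J := hl _ (star_mem ha) _ hb
  have hcj : ‖c - j‖ < δ := by
    rw [hc, hj, ← mul_sub]
    exact (norm_mul_le _ _).trans_lt (by rwa [norm_star])
  have hmem : ∀ g : ℝ → ℝ, Continuous g → g 0 = 0 → cfc g c ∈ B := by
    intro g hg hg0
    rw [← cfcₙ_eq_cfc hg.continuousOn hg0]
    have := hB
    exact cfcₙ_mem (𝕜' := ℂ) g hcB
  have hg0 : cutoff δ 0 = 0 := cutoff_of_le hδ0 hδ0.le
  have hgc := continuous_cutoff hδ0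
  -- This is `cutoff δ t / t ^ m`: the cutoff vanishes for `t ≤ δ`, so the maximum only removes the
  -- singularity and bounds the quotient by `δ⁻¹ ^ m`.
  let gm : ℕ → ℝ → ℝ := fun m t => cutoff δ t * ((max t δ)⁻¹) ^ m
  have hgmc : ∀ m, Continuous (gm m) := fun m => hgc.mul
    (((continuous_id.max continuous_const).inv₀ fun t => (lt_max_of_lt_right hδ0).ne').pow m)
  have hgm0 : ∀ m, gm m 0 = 0 := fun m => by simp [gm, hg0]
  have hfac : ∀ m, cfc (cutoff δ) c = cfc (gm m) c * c ^ m := by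
    intro m
    rw [← cfc_pow_id (R := ℝ) c m, ← cfc_mul (gm m) (fun t => t ^ m) c (hgmc m).continuousOn
      (continuous_pow m).continuousOn]
    congr 1
    funext t
    by_cases ht : t ≤ δ
    · simp [gm, cutoff_of_le hδ0 ht]
    · push Not at ht
      have : t ≠ 0 := (hδ0.trans ht).ne'
      simp only [gm, max_eq_left ht.le]
      rw [mul_assoc, ← mul_pow, inv_mul_cancel₀ this, one_pow, mul_one]
  have hgJ : cfc (cutoff δ) c ∈ J := by
    have hcl : cfc (cutoff δ) c ∈ closure (J : Set A) := by
      -- Modulo `J` the powers of `c` and `c - j` agree. As `‖c - j‖ < δ`, the term `gm(c) (c -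
      -- j)^m` tends to `0`, and `cutoff(c) = gm(c) c^m` is a limit of elements of `J`.
      have hlim : Filter.Tendsto (fun m => cfc (gm m) c * (c ^ m - (c - j) ^ m)) Filter.atTop
          (nhds (cfc (cutoff δ) c)) := by
        rw [tendsto_iff_norm_sub_tendsto_zero]
        have hbd : ∀ m, ‖cfc (gm m) c * (c ^ m - (c - j) ^ m) - cfc (cutoff δ) c‖
            ≤ (‖c - j‖ / δ) ^ m * ‖(1 : A)‖ := by
          intro m
          have h1 : cfc (gm m) c * (c ^ m - (c - j) ^ m) - cfc (cutoff δ) c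
              = -(cfc (gm m) c * (c - j) ^ m) := by
            rw [hfac m]
            noncomm_ring
          have h2 : ‖cfc (gm m) c‖ ≤ (δ⁻¹) ^ m := by
            refine norm_cfc_le (by positivity) fun t _ => ?_
            rw [Real.norm_eq_abs]
            simp only [gm]
            rw [abs_mul, abs_of_nonneg (a := ((max t δ)⁻¹) ^ m)
              (pow_nonneg (inv_nonneg.2 (hδ0.le.trans (le_max_right _ _))) _)]
            calc _ ≤ 1 * (δ⁻¹) ^ m := by
                  gcongr
                  · exact abs_cutoff_le hδ0 t
                  · exact le_max_right _ _
              _ = _ := one_mul _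
          have h3 : ‖(c - j) ^ m‖ ≤ ‖c - j‖ ^ m * ‖(1 : A)‖ := by
            rw [← mul_one ((c - j) ^ m)]
            clear h1 h2
            induction m with
            | zero => simp
            | succ m ih =>
              rw [pow_succ', pow_succ', mul_assoc, mul_assoc]
              exact (norm_mul_le _ _).trans (by gcongr)
          rw [h1, norm_neg]
          refine (norm_mul_le _ _).trans ?_
          calc _ ≤ (δ⁻¹) ^ m * (‖c - j‖ ^ m * ‖(1 : A)‖) := by gcongr
            _ = _ := by rw [div_eq_mul_inv, mul_pow]; ring
        refine squeeze_zero (fun _ => norm_nonneg _) hbd ?_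
        simpa using (tendsto_pow_atTop_nhds_zero_of_lt_one (r := ‖c - j‖ / δ) (by positivity)
          ((div_lt_one hδ0).2 hcj)).mul_const ‖(1 : A)‖
      refine mem_closure_of_tendsto hlim (Filter.Eventually.of_forall fun m => ?_)
      exact hl _ (hmem _ (hgmc m) (hgm0 m)) _
        (pow_sub_pow_mem J hjJ (hl c hcB) (hr c hcB) hJ m)
    rwa [hJc.closure_eq] at hcl
  -- The squared error is the norm of `t (δ / max t δ)²` applied to `star a * a`, which is at most
  -- `δ`.
  refine ⟨a * cfc (cutoff δ) c, hl _ ha _ hgJ, mul_mem ha (hmem _ hgc hg0), ?_⟩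
  let k : ℝ → ℝ := fun t => 1 - cutoff δ t
  have hkc : Continuous k := continuous_const.sub hgc
  have hk : a - a * cfc (cutoff δ) c = a * cfc k c := by
    rw [cfc_sub (fun _ => (1 : ℝ)) (cutoff δ) c continuous_const.continuousOn hgc.continuousOn,
      cfc_const_one ℝ c, mul_sub, mul_one]
  have hksa : star (cfc k c) = cfc k c := (cfc_predicate k c : IsSelfAdjoint (cfc k c)).star_eq
  have hsq : star (a * cfc k c) * (a * cfc k c) = cfc (fun t => k t * t * k t) c := by
    rw [star_mul, hksa, cfc_mul (fun t => k t * t) k c (hkc.mul continuous_id).continuousOn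
      hkc.continuousOn, cfc_mul k (fun t => t) c hkc.continuousOn continuous_id.continuousOn,
      cfc_id' ℝ c, hc]
    simp only [mul_assoc]
  rw [hk, sq, ← CStarRing.norm_star_mul_self, hsq]
  refine norm_cfc_le hδ0.le fun t ht => ?_
  have ht0 : 0 ≤ t := spectrum_star_mul_self_nonneg t ht
  have hkt : k t = δ / max t δ := by simp [k, cutoff]
  rw [hkt, Real.norm_of_nonneg (by positivity)]
  have h1 : 0 < max t δ := lt_max_of_lt_right hδ0
  have h2 : δ / max t δ ≤ 1 := (div_le_one h1).2 (le_max_right _ _)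
  have h3 : t / max t δ ≤ 1 := (div_le_one h1).2 (le_max_left _ _)
  calc δ / max t δ * t * (δ / max t δ) = δ * (δ / max t δ) * (t / max t δ) := by ring
    _ ≤ δ * 1 * 1 := by gcongr
    _ = δ := by ring

end Approximation

/-! ### Levels and matrix units of `𝔅`. -/

namespace RowContractiveRep

variable {n : ℕ} {X : Type u} [TopologicalSpace X] {S : MultiSystem n X}
variable {H : Type u} [NormedAddCommGroup H] [InnerProductSpace ℂ H] [CompleteSpace H]
variable (ρ : RowContractiveRep S H)

/-- The element `t_u f t_v*`. -/
noncomputable def gen (u : List (Fin n)) (f : C₀(X, ℂ)) (v : List (Fin n)) : H →L[ℂ] H :=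
  ρ.word u * ρ.π f * star (ρ.word v)

theorem continuous_π : Continuous ρ.π :=
  AddMonoidHomClass.continuous_of_bound ρ.π 1 fun f => by
    simpa using NonUnitalStarAlgHom.norm_apply_le ρ.π f

theorem continuous_gen (u v : List (Fin n)) : Continuous fun f => ρ.gen u f v :=
  (continuous_const.mul ρ.continuous_π).mul continuous_const

@[simp]
theorem gen_nil (f : C₀(X, ℂ)) : ρ.gen [] f [] = ρ.π f := by simp [gen]

theorem star_gen (u v : List (Fin n)) (f : C₀(X, ℂ)) :
    star (ρ.gen u f v) = ρ.gen v (star f) u := by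
  simp [gen, mul_assoc, map_star]

theorem gen_smul (c : ℂ) (u v : List (Fin n)) (f : C₀(X, ℂ)) :
    ρ.gen u (c • f) v = c • ρ.gen u f v := by
  simp [gen]

theorem star_V:
    star ρ.V = ((Real.sqrt n : ℂ)⁻¹) • ∑ i, star (ρ.T i) := by
  have h1 : star ((Real.sqrt n : ℂ)⁻¹) = (Real.sqrt n : ℂ)⁻¹ := by
    rw [star_inv₀]
    congr 1
    exact Complex.conj_ofReal _
  rw [V, star_smul, h1, star_sum]

theorem inv_sqrt_mul_self (n : ℕ) : (Real.sqrt n : ℂ)⁻¹ * (Real.sqrt n : ℂ)⁻¹ = (n : ℂ)⁻¹ := by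
  rw [← mul_inv, ← Complex.ofReal_mul, Real.mul_self_sqrt (Nat.cast_nonneg _)]
  simp

theorem α_gen (u v : List (Fin n)) (f : C₀(X, ℂ)) :
    ρ.α (ρ.gen u f v) = (n : ℂ)⁻¹ • ∑ i, ∑ j, ρ.gen (i :: u) f (j :: v) := by
  rw [α, star_V, V, smul_mul_assoc, smul_mul_assoc, mul_smul_comm, smul_smul, inv_sqrt_mul_self,
    Finset.sum_mul, Finset.sum_mul]
  congr 1
  refine Finset.sum_congr rfl fun i _ => ?_
  rw [Finset.mul_sum]
  refine Finset.sum_congr rfl fun j _ => ?_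
  simp only [gen, word_cons, star_mul, mul_assoc]

theorem continuous_α : Continuous ρ.α :=
  (continuous_const.mul continuous_id).mul continuous_const

variable {ρ}

namespace IsCuntz

theorem star_word_mul (hρ : ρ.IsCuntz) {v w : List (Fin n)} (hl : v.length = w.length)
    (f : C₀(X, ℂ)) :
    star (ρ.word v) * (ρ.word w * ρ.π f) = if v = w then ρ.π f else 0 := by
  induction v generalizing w with
  | nil =>
    cases w with
    | nil => simp
    | cons j w => simp at hl
  | cons i v ih =>
    cases w with
    | nil => simp at hl
    | cons j w =>
      rw [word_cons, word_cons, star_mul, mul_assoc, mul_assoc, hρ.star_T_mul]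
      by_cases hij : i = j
      · subst hij
        rw [if_pos rfl, ih (by simpa using hl)]
        simp
      · rw [if_neg hij, mul_zero, if_neg]
        intro h
        exact hij (List.cons.inj h).1

theorem π_mul_star_word (hρ : ρ.IsCuntz) {v w : List (Fin n)} (hl : v.length = w.length)
    (f : C₀(X, ℂ)) :
    ρ.π f * (star (ρ.word v) * ρ.word w) = if v = w then ρ.π f else 0 := by
  have h := congrArg star (hρ.star_word_mul hl.symm (star f))
  rw [star_mul, star_mul, star_star, ← map_star, star_star, mul_assoc] at h
  rw [h]
  by_cases hvw : v = w
  · subst hvw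
    rw [if_pos rfl, if_pos rfl, ← map_star, star_star]
  · rw [if_neg hvw, if_neg (Ne.symm hvw), star_zero]

theorem star_word_gen_word (hρ : ρ.IsCuntz) {u v u' v' : List (Fin n)} (hu : u'.length = u.length)
    (hv : v.length = v'.length) (f : C₀(X, ℂ)) :
    star (ρ.word u') * ρ.gen u f v * ρ.word v'
      = if u' = u then (if v = v' then ρ.π f else 0) else 0 := by
  have : star (ρ.word u') * ρ.gen u f v * ρ.word v'
      = star (ρ.word u') * (ρ.word u * ρ.π f) * (star (ρ.word v) * ρ.word v') := by
    simp only [gen, mul_assoc]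
  rw [this, hρ.star_word_mul hu]
  split_ifs with h1 h2
  · rw [hρ.π_mul_star_word hv, if_pos h2]
  · rw [hρ.π_mul_star_word hv, if_neg h2]
  · rw [zero_mul]

theorem gen_mul_gen (hρ : ρ.IsCuntz) {u v w z : List (Fin n)} (hl : v.length = w.length)
    (f g : C₀(X, ℂ)) :
    ρ.gen u f v * ρ.gen w g z = if v = w then ρ.gen u (f * g) z else 0 := by
  have : ρ.gen u f v * ρ.gen w g z
      = ρ.word u * ρ.π f * (star (ρ.word v) * (ρ.word w * ρ.π g)) * star (ρ.word z) := by
    simp only [gen, mul_assoc]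
  rw [this, hρ.star_word_mul hl]
  split_ifs
  · rw [gen, map_mul, mul_assoc (ρ.word u)]
  · simp

/-- This is the embedding of a level into the next one, obtained by inserting `f = ∑ t_i (f ∘ σ_i)
t_i*` in the middle. -/
theorem gen_eq_sum (hρ : ρ.IsCuntz) (u v : List (Fin n)) (f : C₀(X, ℂ)) :
    ρ.gen u f v = ∑ i, ρ.gen (u ++ [i]) (S.pull i f) (v ++ [i]) := by
  rw [gen, ← hρ.sum_eq f, Finset.mul_sum, Finset.sum_mul]
  refine Finset.sum_congr rfl fun i _ => ?_
  simp only [gen, word_append, word_cons, word_nil, mul_one, star_mul, mul_assoc]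

theorem π_injective (hρ : ρ.IsCuntz) : Function.Injective ρ.π := by
  rw [injective_iff_map_eq_zero]
  intro f hf
  rw [← norm_eq_zero, ← hρ.norm_π, hf, norm_zero]

theorem isClosed_range_π (hρ : ρ.IsCuntz) : IsClosed (Set.range ρ.π) :=
  (AddMonoidHomClass.isometry_of_norm ρ.π hρ.norm_π).isClosedEmbedding.isClosed_range

end IsCuntz

variable (ρ)

/-- The span of the elements `t_u f t_v*` with `|u| = |v| = k` and `f ∈ I`. -/
noncomputable def level (I : Set C₀(X, ℂ)) (k : ℕ) : Submodule ℂ (H →L[ℂ] H) :=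
  Submodule.span ℂ {b | ∃ (u v : List (Fin n)) (f : C₀(X, ℂ)),
    u.length = k ∧ v.length = k ∧ f ∈ I ∧ b = ρ.gen u f v}

/-- The closed span of the elements `t_u f t_v*` with `|u| = |v|` and `f ∈ I`. -/
noncomputable def closedSpan (I : Set C₀(X, ℂ)) : Submodule ℂ (H →L[ℂ] H) :=
  (Submodule.span ℂ {b | ∃ (u v : List (Fin n)) (f : C₀(X, ℂ)),
    u.length = v.length ∧ f ∈ I ∧ b = ρ.gen u f v}).topologicalClosure

theorem isClosed_closedSpan (I : Set C₀(X, ℂ)) : IsClosed (ρ.closedSpan I : Set (H →L[ℂ] H)) :=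
  Submodule.isClosed_topologicalClosure _

theorem gen_mem_closedSpan {I : Set C₀(X, ℂ)} {u v : List (Fin n)} (h : u.length = v.length)
    {f : C₀(X, ℂ)} (hf : f ∈ I) : ρ.gen u f v ∈ ρ.closedSpan I :=
  Submodule.le_topologicalClosure _ (Submodule.subset_span ⟨u, v, f, h, hf, rfl⟩)

theorem gen_mem_level {I : Set C₀(X, ℂ)} {k : ℕ} {u v : List (Fin n)} (hu : u.length = k)
    (hv : v.length = k) {f : C₀(X, ℂ)} (hf : f ∈ I) : ρ.gen u f v ∈ ρ.level I k :=
  Submodule.subset_span ⟨u, v, f, hu, hv, hf, rfl⟩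

theorem closedSpan_univ : ρ.closedSpan Set.univ = ρ.𝔅 := by
  rw [closedSpan, 𝔅]
  congr 2
  ext b
  simp [gen]

theorem gen_mem_𝔅 {u v : List (Fin n)} (h : u.length = v.length) (f : C₀(X, ℂ)) :
    ρ.gen u f v ∈ ρ.𝔅 := by
  rw [← closedSpan_univ]
  exact ρ.gen_mem_closedSpan h (Set.mem_univ f)

theorem level_le_closedSpan (I : Set C₀(X, ℂ)) (k : ℕ) : ρ.level I k ≤ ρ.closedSpan I := by
  refine Submodule.span_le.2 ?_
  rintro _ ⟨u, v, f, hu, hv, hf, rfl⟩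
  exact ρ.gen_mem_closedSpan (hu.trans hv.symm) hf

theorem closedSpan_le {I : Set C₀(X, ℂ)} {J : Submodule ℂ (H →L[ℂ] H)}
    (hJ : IsClosed (J : Set (H →L[ℂ] H)))
    (h : ∀ u v f, u.length = v.length → f ∈ I → ρ.gen u f v ∈ J) : ρ.closedSpan I ≤ J := by
  refine Submodule.topologicalClosure_minimal _ (Submodule.span_le.2 ?_) hJ
  rintro _ ⟨u, v, f, huv, hf, rfl⟩
  exact h u v f huv hf

variable {ρ}

theorem IsCuntz.level_mono (hρ : ρ.IsCuntz) {I : Set C₀(X, ℂ)}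
    (hI : ∀ i, ∀ f ∈ I, S.pull i f ∈ I) : Monotone (ρ.level I) := by
  refine monotone_nat_of_le_succ fun k => Submodule.span_le.2 ?_
  rintro _ ⟨u, v, f, hu, hv, hf, rfl⟩
  rw [hρ.gen_eq_sum]
  exact Submodule.sum_mem _ fun i _ =>
    ρ.gen_mem_level (by simp [hu]) (by simp [hv]) (hI i f hf)

/-- The closed span is the closure of the union of the levels. -/
theorem IsCuntz.closedSpan_eq_closure (hρ : ρ.IsCuntz) {I : Set C₀(X, ℂ)}
    (hI : ∀ i, ∀ f ∈ I, S.pull i f ∈ I) :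
    (ρ.closedSpan I : Set (H →L[ℂ] H)) = closure (⋃ k, (ρ.level I k : Set (H →L[ℂ] H))) := by
  rw [closedSpan, Submodule.topologicalClosure_coe,
    ← Submodule.coe_iSup_of_directed _ (hρ.level_mono hI).directed_le]
  congr 2
  refine le_antisymm (Submodule.span_le.2 ?_) (iSup_le fun k => Submodule.span_mono ?_)
  · rintro _ ⟨u, v, f, huv, hf, rfl⟩
    exact Submodule.mem_iSup_of_mem _ (ρ.gen_mem_level rfl huv.symm hf)
  · rintro _ ⟨u, v, f, hu, hv, hf, rfl⟩
    exact ⟨u, v, f, hu.trans hv.symm, hf, rfl⟩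

theorem IsCuntz.mul_mem_level (hρ : ρ.IsCuntz) {I I' I'' : Set C₀(X, ℂ)}
    (h : ∀ f ∈ I, ∀ g ∈ I', f * g ∈ I'') {k : ℕ} {a b : H →L[ℂ] H} (ha : a ∈ ρ.level I k)
    (hb : b ∈ ρ.level I' k) : a * b ∈ ρ.level I'' k := by
  induction ha, hb using Submodule.span_induction₂ with
  | mem_mem a b ha hb =>
    obtain ⟨u, v, f, hu, hv, hf, rfl⟩ := ha
    obtain ⟨w, z, g, hw, hz, hg, rfl⟩ := hb
    rw [hρ.gen_mul_gen (hv.trans hw.symm)]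
    split_ifs
    · exact ρ.gen_mem_level hu hz (h f hf g hg)
    · exact Submodule.zero_mem _
  | zero_left => rw [zero_mul]; exact Submodule.zero_mem _
  | zero_right => rw [mul_zero]; exact Submodule.zero_mem _
  | add_left x y z _ _ _ h1 h2 => rw [add_mul]; exact Submodule.add_mem _ h1 h2
  | add_right x y z _ _ _ h1 h2 => rw [mul_add]; exact Submodule.add_mem _ h1 h2
  | smul_left c x y _ _ h1 => rw [smul_mul_assoc]; exact Submodule.smul_mem _ _ h1
  | smul_right c x y _ _ h1 => rw [mul_smul_comm]; exact Submodule.smul_mem _ _ h1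

theorem IsCuntz.mul_mem_closedSpan (hρ : ρ.IsCuntz) {I I' I'' : Set C₀(X, ℂ)}
    (hI : ∀ i, ∀ f ∈ I, S.pull i f ∈ I) (hI' : ∀ i, ∀ f ∈ I', S.pull i f ∈ I')
    (h : ∀ f ∈ I, ∀ g ∈ I', f * g ∈ I'') {a b : H →L[ℂ] H} (ha : a ∈ ρ.closedSpan I)
    (hb : b ∈ ρ.closedSpan I') : a * b ∈ ρ.closedSpan I'' := by
  rw [← SetLike.mem_coe, hρ.closedSpan_eq_closure hI] at ha
  rw [← SetLike.mem_coe, hρ.closedSpan_eq_closure hI'] at hb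
  have h1 : ∀ x ∈ ⋃ k, (ρ.level I k : Set (H →L[ℂ] H)),
      ∀ y ∈ ⋃ k, (ρ.level I' k : Set (H →L[ℂ] H)),
      x * y ∈ (ρ.closedSpan I'' : Set (H →L[ℂ] H)) := by
    intro x hx y hy
    obtain ⟨k, hx⟩ := Set.mem_iUnion.1 hx
    obtain ⟨l, hy⟩ := Set.mem_iUnion.1 hy
    exact ρ.level_le_closedSpan _ _ (hρ.mul_mem_level h (hρ.level_mono hI (le_max_left k l) hx)
      (hρ.level_mono hI' (le_max_right k l) hy))
  have h2 := map_mem_closure₂ (f := fun x y : H →L[ℂ] H => x * y) continuous_mul ha hb h1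
  rwa [(ρ.isClosed_closedSpan I'').closure_eq] at h2

/-- The star subalgebra of all elements of level `k`. -/
noncomputable def IsCuntz.levelAlgebra (hρ : ρ.IsCuntz) (k : ℕ) :
    NonUnitalStarSubalgebra ℂ (H →L[ℂ] H) where
  __ := ρ.level Set.univ k
  mul_mem' ha hb := hρ.mul_mem_level (fun _ _ _ _ => Set.mem_univ _) ha hb
  star_mem' {a} ha := by
    change star a ∈ ρ.level Set.univ k
    replace ha : a ∈ ρ.level Set.univ k := ha
    induction ha using Submodule.span_induction with
    | mem x hx =>
      obtain ⟨u, v, f, hu, hv, hf, rfl⟩ := hx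
      rw [star_gen]
      exact ρ.gen_mem_level hv hu (Set.mem_univ _)
    | zero => rw [star_zero]; exact Submodule.zero_mem _
    | add x y _ _ hx hy => rw [star_add]; exact Submodule.add_mem _ hx hy
    | smul c x _ hx => rw [star_smul]; exact Submodule.smul_mem _ _ hx

/-- Matrix entries of the elements in the closure of a level. -/
theorem IsCuntz.exists_entries (hρ : ρ.IsCuntz) {k : ℕ} {b : H →L[ℂ] H}
    (hb : b ∈ closure (ρ.level Set.univ k : Set (H →L[ℂ] H))) :
    ∃ g : List (Fin n) → List (Fin n) → C₀(X, ℂ),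
      (∀ u v, u.length = k → v.length = k → star (ρ.word u) * b * ρ.word v = ρ.π (g u v)) ∧
      b = ∑ u ∈ (wordsUpTo n k).filter (fun u => u.length = k),
        ∑ v ∈ (wordsUpTo n k).filter (fun v => v.length = k), ρ.gen u (g u v) v := by
  -- The range of the isometric `π` is closed, so the entries of a limit are again functions and
  -- generators suffice.
  have h1 : ∀ u v : List (Fin n), u.length = k → v.length = k →
      star (ρ.word u) * b * ρ.word v ∈ Set.range ρ.π := by
    intro u v hu hv
    have hc : Continuous fun b : H →L[ℂ] H => star (ρ.word u) * b * ρ.word v :=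
      (continuous_const.mul continuous_id).mul continuous_const
    have h2 := map_mem_closure (t := Set.range ρ.π) hc hb ?_
    · rwa [hρ.isClosed_range_π.closure_eq] at h2
    · intro x hx
      replace hx : x ∈ ρ.level Set.univ k := hx
      induction hx using Submodule.span_induction with
      | mem x hx =>
        obtain ⟨u', v', f, hu', hv', hf, rfl⟩ := hx
        change star (ρ.word u) * _ * ρ.word v ∈ _
        rw [hρ.star_word_gen_word (hu.trans hu'.symm) (hv'.trans hv.symm)]
        split_ifs
        · exact ⟨f, rfl⟩
        · exact ⟨0, map_zero _⟩
        · exact ⟨0, map_zero _⟩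
      | zero => exact ⟨0, by simp⟩
      | add x y _ _ hx hy =>
        obtain ⟨f, hf⟩ := hx
        obtain ⟨g, hg⟩ := hy
        exact ⟨f + g, by rw [map_add, hf, hg]; simp [mul_add, add_mul]⟩
      | smul c x _ hx =>
        obtain ⟨f, hf⟩ := hx
        exact ⟨c • f, by rw [map_smul, hf]; simp⟩
  have h3 : ∀ u v : List (Fin n), ∃ g : C₀(X, ℂ), u.length = k → v.length = k →
      star (ρ.word u) * b * ρ.word v = ρ.π g := by
    intro u v
    by_cases h : u.length = k ∧ v.length = k
    · obtain ⟨g, hg⟩ := h1 u v h.1 h.2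
      exact ⟨g, fun _ _ => hg.symm⟩
    · exact ⟨0, fun hu hv => absurd ⟨hu, hv⟩ h⟩
  choose g hg using h3
  refine ⟨g, hg, ?_⟩
  have h4 : b = ∑ u ∈ (wordsUpTo n k).filter (fun u => u.length = k),
      ∑ v ∈ (wordsUpTo n k).filter (fun v => v.length = k),
      ρ.word u * (star (ρ.word u) * b * ρ.word v) * star (ρ.word v) := by
    have hcl : IsClosed {b : H →L[ℂ] H | b = ∑ u ∈ (wordsUpTo n k).filter (fun u => u.length = k),
        ∑ v ∈ (wordsUpTo n k).filter (fun v => v.length = k),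
        ρ.word u * (star (ρ.word u) * b * ρ.word v) * star (ρ.word v)} := by
      refine isClosed_eq continuous_id (continuous_finsetSum _ fun u _ =>
        continuous_finsetSum _ fun v _ => ?_)
      exact (continuous_const.mul ((continuous_const.mul continuous_id).mul continuous_const)).mul
        continuous_const
    refine closure_minimal ?_ hcl hb
    intro x hx
    replace hx : x ∈ ρ.level Set.univ k := hx
    change x = _
    induction hx using Submodule.span_induction with
    | mem x hx =>
      obtain ⟨u', v', f, hu', hv', hf, rfl⟩ := hx
      have hmem : ∀ w : List (Fin n), w.length = k →
          w ∈ (wordsUpTo n k).filter (fun u => u.length = k) := fun w hw =>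
        Finset.mem_filter.2 ⟨mem_wordsUpTo.2 hw.le, hw⟩
      rw [Finset.sum_eq_single u', Finset.sum_eq_single v']
      · rw [hρ.star_word_gen_word rfl rfl, if_pos rfl, if_pos rfl, gen]
      · intro v hv hne
        rw [hρ.star_word_gen_word rfl (hv'.trans (Finset.mem_filter.1 hv).2.symm), if_pos rfl,
          if_neg hne.symm, mul_zero, zero_mul]
      · exact fun h => absurd (hmem v' hv') h
      · intro u hu hne
        refine Finset.sum_eq_zero fun v hv => ?_
        rw [hρ.star_word_gen_word ((Finset.mem_filter.1 hu).2.trans hu'.symm)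
          (hv'.trans (Finset.mem_filter.1 hv).2.symm), if_neg hne, mul_zero, zero_mul]
      · exact fun h => absurd (hmem u' hu') h
    | zero => simp
    | add x y _ _ hx hy =>
      conv_lhs => rw [hx, hy]
      simp only [← Finset.sum_add_distrib, mul_add, add_mul]
    | smul c x _ hx =>
      conv_lhs => rw [hx]
      simp only [Finset.smul_sum, mul_smul_comm, smul_mul_assoc]
  conv_lhs => rw [h4]
  refine Finset.sum_congr rfl fun u hu => Finset.sum_congr rfl fun v hv => ?_
  rw [hg u v (Finset.mem_filter.1 hu).2 (Finset.mem_filter.1 hv).2, gen]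

end RowContractiveRep

/-! ### From bi-invariant ideals to closed sets. -/

namespace RowContractiveRep

variable {n : ℕ} {X : Type u} [TopologicalSpace X] {S : MultiSystem n X}
variable {H : Type u} [NormedAddCommGroup H] [InnerProductSpace ℂ H] [CompleteSpace H]
variable {ρ : RowContractiveRep S H} {J : Submodule ℂ (H →L[ℂ] H)}

/-- Multiplication by `t_w e t_u*` and `t_v e t_z*` moves the entry, and the extra factors `e` are
removed by density. -/
theorem IsCuntz.gen_mem_of_mem (hρ : ρ.IsCuntz) (hJ : ρ.IsIdeal J) {u v w z : List (Fin n)}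
    (hwu : w.length = u.length) (hvz : v.length = z.length)
    {f : C₀(X, ℂ)} (hf : ρ.gen u f v ∈ J) : ρ.gen w f z ∈ J := by
  have h1 : ρ.gen w f v ∈ J := by
    refine ZeroAtInftyContinuousMap.map_mem_of_forall_mul (ρ.continuous_gen w v) hJ.closed f
      fun e => ?_
    have := hJ.mul_left _ (ρ.gen_mem_𝔅 hwu e) _ hf
    rwa [hρ.gen_mul_gen rfl, if_pos rfl] at this
  refine ZeroAtInftyContinuousMap.map_mem_of_forall_mul (ρ.continuous_gen w z) hJ.closed f
    fun e => ?_
  have := hJ.mul_right _ (ρ.gen_mem_𝔅 hvz e) _ h1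
  rwa [hρ.gen_mul_gen rfl, if_pos rfl, mul_comm] at this

theorem IsIdeal.gen_mem_of_compression (hJ : ρ.IsIdeal J) {u v : List (Fin n)} {b : H →L[ℂ] H}
    (hb : b ∈ J) {g : C₀(X, ℂ)} (hg : star (ρ.word u) * b * ρ.word v = ρ.π g) :
    ρ.gen u g v ∈ J := by
  refine ZeroAtInftyContinuousMap.map_mem_of_forall_mul (ρ.continuous_gen u v) hJ.closed g
    fun e => ?_
  refine ZeroAtInftyContinuousMap.map_mem_of_forall_mul (ρ.continuous_gen u v) hJ.closed (e * g)
    fun e' => ?_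
  have h1 := hJ.mul_right _ (ρ.gen_mem_𝔅 (u := v) rfl e') _
    (hJ.mul_left _ (ρ.gen_mem_𝔅 (u := u) rfl e) _ hb)
  have h2 : ρ.gen u e u * b * ρ.gen v e' v
      = ρ.word u * ρ.π e * (star (ρ.word u) * b * ρ.word v) * ρ.π e' * star (ρ.word v) := by
    simp only [gen, mul_assoc]
  rw [h2, hg] at h1
  have h3 : e' * (e * g) = e * g * e' := mul_comm _ _
  rw [h3, gen, map_mul, map_mul]
  simp only [mul_assoc] at h1 ⊢
  exact h1

/-- First letters are stripped one at a time. If `t_{iu} f t_{jv}*` is in `J`, so is every choice of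
`i, j`, hence the average `α(t_u f t_v*)`, hence `t_u f t_v*`. Backwards, the `(iu, jv)` entry of
`α(t_u f t_v*)` is `f / n`. -/
theorem IsCuntz.gen_mem_iff (hρ : ρ.IsCuntz) (hJ : ρ.IsBiInvariantIdeal J) {u v : List (Fin n)}
    (huv : u.length = v.length) (f : C₀(X, ℂ)) : ρ.gen u f v ∈ J ↔ ρ.π f ∈ J := by
  induction u generalizing v with
  | nil =>
    cases v with
    | nil => rw [gen_nil]
    | cons j v => simp at huv
  | cons i u ih =>
    cases v with
    | nil => simp at huv
    | cons j v =>
      have huv' : u.length = v.length := by simpa using huv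
      rw [← ih huv']
      constructor
      · intro h
        refine hJ.mem_of_map_mem _ (ρ.gen_mem_𝔅 huv' f) ?_
        rw [α_gen]
        refine J.smul_mem _ (J.sum_mem fun i' _ => J.sum_mem fun j' _ => ?_)
        exact hρ.gen_mem_of_mem hJ.toIsIdeal (by simp) (by simp) h
      · intro h
        have hn : (n : ℂ) ≠ 0 :=
          Nat.cast_ne_zero.2 (Nat.pos_of_ne_zero (by rintro rfl; exact i.elim0)).ne'
        have h1 : star (ρ.word (i :: u)) * ρ.α (ρ.gen u f v) * ρ.word (j :: v)
            = ρ.π ((n : ℂ)⁻¹ • f) := by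
          rw [α_gen, mul_smul_comm, smul_mul_assoc, map_smul, Finset.mul_sum, Finset.sum_mul]
          congr 1
          simp only [Finset.mul_sum, Finset.sum_mul]
          rw [Finset.sum_eq_single i, Finset.sum_eq_single j]
          · rw [hρ.star_word_gen_word (by simp) (by simp), if_pos rfl, if_pos rfl]
          · intro j' _ hj
            rw [hρ.star_word_gen_word (by simp) (by simp), if_pos rfl, if_neg (by simp [hj])]
          · simp
          · intro i' _ hi
            refine Finset.sum_eq_zero fun j' _ => ?_
            rw [hρ.star_word_gen_word (by simp) (by simp), if_neg (by simp [hi.symm])]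
          · simp
        have h2 := hJ.toIsIdeal.gen_mem_of_compression (hJ.map_mem _ h) h1
        rw [gen_smul] at h2
        have h3 := J.smul_mem (n : ℂ) h2
        rwa [smul_smul, mul_inv_cancel₀ hn, one_smul] at h3

/-- The compression `t_i* f t_i` is `f ∘ σ_i`. -/
theorem IsCuntz.pull_mem (hρ : ρ.IsCuntz) (hJ : ρ.IsBiInvariantIdeal J) (i : Fin n)
    {f : C₀(X, ℂ)} (hf : ρ.π f ∈ J) : ρ.π (S.pull i f) ∈ J := by
  rw [← hρ.gen_mem_iff hJ (u := [i]) (v := [i]) rfl]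
  refine hJ.toIsIdeal.gen_mem_of_compression hf ?_
  have h := hρ.star_T_mul i i [] (S.pull i f)
  rw [if_pos rfl, word_nil, one_mul] at h
  rw [word_cons, word_nil, mul_one, mul_assoc, ρ.covariant, h]

theorem IsCuntz.mem_of_pull_mem (hρ : ρ.IsCuntz) (hJ : ρ.IsBiInvariantIdeal J)
    {f : C₀(X, ℂ)} (hf : ∀ i, ρ.π (S.pull i f) ∈ J) : ρ.π f ∈ J := by
  rw [← gen_nil, hρ.gen_eq_sum]
  exact J.sum_mem fun i _ => (hρ.gen_mem_iff hJ (by simp) _).2 (hf i)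

/-- The common zero set of the functions in `J`. -/
def hull (ρ : RowContractiveRep S H) (J : Submodule ℂ (H →L[ℂ] H)) : Set X :=
  {x | ∀ f : C₀(X, ℂ), ρ.π f ∈ J → f x = 0}

theorem isClosed_hull (ρ : RowContractiveRep S H) (J : Submodule ℂ (H →L[ℂ] H)) :
    IsClosed (ρ.hull J) := by
  have : ρ.hull J = ⋂ (f : C₀(X, ℂ)) (_ : ρ.π f ∈ J), {x | f x = 0} := by
    ext x
    simp [hull]
  rw [this]
  exact isClosed_iInter fun f => isClosed_iInter fun _ => isClosed_eq f.continuous continuous_const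

theorem IsIdeal.π_mem_iff (hJ : ρ.IsIdeal J) (f : C₀(X, ℂ)) :
    ρ.π f ∈ J ↔ ∀ x ∈ ρ.hull J, f x = 0 := by
  refine ⟨fun h x hx => hx f h, fun h => ?_⟩
  let I : Submodule ℂ C₀(X, ℂ) := J.comap (ρ.π : C₀(X, ℂ) →ₗ[ℂ] (H →L[ℂ] H))
  refine ZeroAtInftyContinuousMap.mem_of_vanishing I (hJ.closed.preimage ρ.continuous_π)
    (fun f g hg => ?_) f fun x hx => h x fun g hg => hx g hg
  change ρ.π (f * g) ∈ J
  rw [map_mul]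
  refine hJ.mul_left _ ?_ _ hg
  rw [← gen_nil]
  exact ρ.gen_mem_𝔅 rfl f

theorem IsCuntz.biInvariant_hull [LocallyCompactSpace X] [T2Space X] (hρ : ρ.IsCuntz)
    (hS : S.IsFree) (hJ : ρ.IsBiInvariantIdeal J) : S.BiInvariant (ρ.hull J) := by
  intro i
  constructor
  · rintro _ ⟨x, hx, rfl⟩ f hf
    exact hx _ (hρ.pull_mem hJ i hf)
  · intro x hx
    have hG : IsClosed (⋃ j, S.map j '' ρ.hull J) :=
      isClosed_iUnion_of_finite fun j => (S.proper j).isClosedMap _ (ρ.isClosed_hull J)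
    -- Proper maps are closed, so otherwise some function is `1` at `σ_i x` and vanishes on all
    -- images of the hull. All its pullbacks, hence the function itself, would lie in `J`. Freeness
    -- then identifies `x` with the point of the hull found here.
    have hxG : S.map i x ∈ ⋃ j, S.map j '' ρ.hull J := by
      by_contra hcon
      obtain ⟨f, hf1, hf0⟩ := ZeroAtInftyContinuousMap.exists_apply_eq_one hG hcon
      have hfJ : ρ.π f ∈ J := hρ.mem_of_pull_mem hJ fun j =>
        (hJ.toIsIdeal.π_mem_iff _).2 fun y hy =>
          hf0 _ (Set.mem_iUnion.2 ⟨j, y, hy, rfl⟩)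
      exact one_ne_zero (hf1.symm.trans (hx f hfJ))
    obtain ⟨j, y, hy, hyx⟩ := Set.mem_iUnion.1 hxG
    rwa [← (hS _ _ _ _ hyx).2]

/-- A bi-invariant ideal is generated by its functions. -/
theorem IsCuntz.closedSpan_eq (hρ : ρ.IsCuntz) (hJ : ρ.IsBiInvariantIdeal J) :
    ρ.closedSpan {f | ρ.π f ∈ J} = J := by
  refine le_antisymm (ρ.closedSpan_le hJ.closed fun u v f huv hf =>
    (hρ.gen_mem_iff hJ huv f).2 hf) fun b hb => ?_
  have hb𝔅 := hJ.le hb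
  rw [← closedSpan_univ, ← SetLike.mem_coe, hρ.closedSpan_eq_closure fun _ _ _ => Set.mem_univ _,
    Metric.mem_closure_iff] at hb𝔅
  rw [← SetLike.mem_coe, ← (ρ.isClosed_closedSpan _).closure_eq, Metric.mem_closure_iff]
  intro ε hε
  -- The bounds give `‖a‖ ≤ ‖b‖ + 1` and `‖a‖ ‖a - b‖ < (ε / 2)²`, the input of
  -- `exists_mem_inter_near`.
  set η : ℝ := min 1 (min (ε / 2) ((ε / 2) ^ 2 / (‖b‖ + 2))) with hη
  have hη0 : 0 < η := by positivity
  obtain ⟨a, ha, hab⟩ := hb𝔅 η hη0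
  obtain ⟨k, hak⟩ := Set.mem_iUnion.1 ha
  have hη1 : η ≤ 1 := min_le_left _ _
  have hη2 : η ≤ ε / 2 := (min_le_right _ _).trans (min_le_left _ _)
  have hη3 : η * (‖b‖ + 2) ≤ (ε / 2) ^ 2 :=
    (le_div_iff₀ (by positivity)).1 ((min_le_right _ _).trans (min_le_right _ _))
  have hab' : ‖a - b‖ < η := by rwa [dist_comm, dist_eq_norm] at hab
  have hanorm : ‖a‖ ≤ ‖b‖ + 1 := by
    have := norm_le_norm_add_norm_sub' a b
    linarith
  have hδ : ‖a‖ * ‖a - b‖ < (ε / 2) ^ 2 := by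
    have h1 : ‖a‖ * ‖a - b‖ ≤ (‖b‖ + 1) * η := by gcongr
    nlinarith
  have hB𝔅 : ∀ x ∈ (hρ.levelAlgebra k).topologicalClosure, x ∈ ρ.𝔅 := by
    intro x hx
    have h1 : x ∈ closure (ρ.level Set.univ k : Set (H →L[ℂ] H)) := hx
    have h2 := closure_mono (ρ.level_le_closedSpan Set.univ k) h1
    rwa [(ρ.isClosed_closedSpan _).closure_eq, closedSpan_univ] at h2
  obtain ⟨b', hb'J, hb'B, hab''⟩ := exists_mem_inter_near (hρ.levelAlgebra k).topologicalClosure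
    (NonUnitalStarSubalgebra.isClosed_topologicalClosure _) J hJ.closed
    (fun x hx y hy => hJ.mul_left x (hB𝔅 x hx) y hy)
    (fun x hx y hy => hJ.mul_right x (hB𝔅 x hx) y hy)
    (fun x hx y hy => hJ.mul_left x (hJ.le hx) y hy)
    (NonUnitalStarSubalgebra.le_topologicalClosure _ hak) hb hδ
  refine ⟨b', ?_, ?_⟩
  · obtain ⟨g, hg, hsum⟩ := hρ.exists_entries (k := k) (b := b') hb'B
    rw [hsum]
    refine Submodule.sum_mem _ fun u hu => Submodule.sum_mem _ fun v hv => ?_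
    have hu' := (Finset.mem_filter.1 hu).2
    have hv' := (Finset.mem_filter.1 hv).2
    refine ρ.gen_mem_closedSpan (hu'.trans hv'.symm) ?_
    exact (hρ.gen_mem_iff hJ (hu'.trans hv'.symm) _).1
      (hJ.toIsIdeal.gen_mem_of_compression hb'J (hg u v hu' hv'))
  · have h1 : ‖a - b'‖ ≤ ε / 2 := (sq_le_sq₀ (norm_nonneg _) (by positivity)).1 hab''
    calc dist b b' ≤ dist b a + dist a b' := dist_triangle _ _ _
      _ < ε / 2 + ε / 2 := by
        rw [dist_eq_norm a b']
        linarith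
      _ = ε := by ring

/-! ### From closed sets to bi-invariant ideals. -/

section Converse

variable {F : Set X}

theorem pull_mem_vanishing (hF : S.BiInvariant F) (i : Fin n) (f : C₀(X, ℂ))
    (hf : f ∈ {f : C₀(X, ℂ) | ∀ x ∈ F, f x = 0}) :
    S.pull i f ∈ {f : C₀(X, ℂ) | ∀ x ∈ F, f x = 0} :=
  fun x hx => hf _ ((hF i).1 ⟨x, hx, rfl⟩)

theorem exists_act_eq (hsurj : S.IsSurjective) (hF : S.BiInvariant F) (k : ℕ) {x : X}
    (hx : x ∈ F) : ∃ w : List (Fin n), w.length = k ∧ ∃ y ∈ F, S.act w y = x := by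
  induction k generalizing x with
  | zero => exact ⟨[], rfl, x, hx, rfl⟩
  | succ k ih =>
    obtain ⟨i, y, rfl⟩ := hsurj x
    obtain ⟨w, hw, z, hz, rfl⟩ := ih ((hF i).2 hx)
    exact ⟨i :: w, by simp [hw], z, hz, rfl⟩

theorem norm_word_le (ρ : RowContractiveRep S H) (w : List (Fin n)) : ‖ρ.word w‖ ≤ 1 := by
  induction w with
  | nil => exact ContinuousLinearMap.norm_id_le
  | cons i w ih =>
    have hT : ‖ρ.T i‖ ≤ 1 := by
      refine ContinuousLinearMap.opNorm_le_bound _ zero_le_one fun h => ?_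
      have h1 := ρ.row_contractive (Pi.single i h)
      rw [Finset.sum_eq_single i, Finset.sum_eq_single i, Pi.single_eq_same] at h1
      · rw [one_mul]
        exact (sq_le_sq₀ (norm_nonneg _) (norm_nonneg _)).1 h1
      · intro j _ hj
        simp [Pi.single_eq_of_ne hj]
      · simp
      · intro j _ hj
        simp [Pi.single_eq_of_ne hj]
      · simp
    rw [word_cons]
    exact (norm_mul_le _ _).trans (mul_le_one₀ hT (norm_nonneg _) ih)

/-- Let `f` be within `ε` of an element of level `k`, and write `x ∈ F` as `σ_w(y)` with `|w| = k`
and `y ∈ F`. Compression by `t_w` turns `f` into `f ∘ σ_w` and the other element into a function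
vanishing at `y`, so `|f(x)| ≤ ε`. -/
theorem IsCuntz.π_mem_closedSpan_iff (hρ : ρ.IsCuntz)
    (hsurj : S.IsSurjective) (hF : S.BiInvariant F) (f : C₀(X, ℂ)) :
    ρ.π f ∈ ρ.closedSpan {f : C₀(X, ℂ) | ∀ x ∈ F, f x = 0} ↔ ∀ x ∈ F, f x = 0 := by
  constructor
  swap
  · intro h
    rw [← gen_nil]
    exact ρ.gen_mem_closedSpan rfl h
  intro h x hx
  rw [← SetLike.mem_coe, hρ.closedSpan_eq_closure (pull_mem_vanishing hF),
    Metric.mem_closure_iff] at h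
  have key : ∀ ε > 0, ‖f x‖ ≤ ε := by
    intro ε hε
    obtain ⟨b, hb, hfb⟩ := h ε hε
    obtain ⟨k, hbk⟩ := Set.mem_iUnion.1 hb
    obtain ⟨w, hw, y, hy, rfl⟩ := exists_act_eq hsurj hF k hx
    have hent : ∃ g ∈ {f : C₀(X, ℂ) | ∀ x ∈ F, f x = 0},
        star (ρ.word w) * b * ρ.word w = ρ.π g := by
      replace hbk : b ∈ ρ.level {f : C₀(X, ℂ) | ∀ x ∈ F, f x = 0} k := hbk
      clear hfb hb
      induction hbk using Submodule.span_induction with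
      | mem b hb =>
        obtain ⟨u, v, g, hu, hv, hg, rfl⟩ := hb
        rw [hρ.star_word_gen_word (hw.trans hu.symm) (hv.trans hw.symm)]
        split_ifs
        · exact ⟨g, hg, rfl⟩
        · exact ⟨0, fun _ _ => rfl, (map_zero _).symm⟩
        · exact ⟨0, fun _ _ => rfl, (map_zero _).symm⟩
      | zero => exact ⟨0, fun _ _ => rfl, by simp⟩
      | add a b _ _ ha hb =>
        obtain ⟨g, hg, hga⟩ := ha
        obtain ⟨g', hg', hgb⟩ := hb
        refine ⟨g + g', fun x hx => ?_, by rw [map_add, ← hga, ← hgb]; simp [mul_add, add_mul]⟩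
        rw [ZeroAtInftyContinuousMap.add_apply, hg x hx, hg' x hx, add_zero]
      | smul c a _ ha =>
        obtain ⟨g, hg, hga⟩ := ha
        refine ⟨c • g, fun x hx => ?_, by rw [map_smul, ← hga]; simp⟩
        rw [ZeroAtInftyContinuousMap.smul_apply, hg x hx, smul_zero]
    obtain ⟨g, hg, hgb⟩ := hent
    have hfw : star (ρ.word w) * ρ.π f * ρ.word w = ρ.π (S.pullWord w f) := by
      rw [mul_assoc, ρ.covariant_word, hρ.star_word_mul rfl, if_pos rfl]
    have hnorm : ‖S.pullWord w f - g‖ ≤ ε := by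
      rw [← hρ.norm_π, map_sub, ← hfw, ← hgb, ← sub_mul, ← mul_sub]
      calc _ ≤ ‖star (ρ.word w)‖ * ‖ρ.π f - b‖ * ‖ρ.word w‖ :=
            (norm_mul_le _ _).trans (by gcongr; exact norm_mul_le _ _)
        _ ≤ 1 * ε * 1 := by
            rw [norm_star]
            rw [dist_eq_norm] at hfb
            gcongr
            · exact ρ.norm_word_le w
            · exact ρ.norm_word_le w
        _ = ε := by ring
    have h1 := (ZeroAtInftyContinuousMap.norm_apply_le (S.pullWord w f - g) y).trans hnorm
    rwa [ZeroAtInftyContinuousMap.sub_apply, hg y hy, sub_zero, MultiSystem.pullWord_apply] at h1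
  exact norm_le_zero_iff.1 (le_of_forall_pos_le_add fun ε hε => by simpa using key ε hε)

theorem IsCuntz.star_V_mul (hρ : ρ.IsCuntz) (i : Fin n) (u : List (Fin n)) (f : C₀(X, ℂ)) :
    star ρ.V * (ρ.word (i :: u) * ρ.π f) = ((Real.sqrt n : ℂ)⁻¹) • (ρ.word u * ρ.π f) := by
  rw [star_V, smul_mul_assoc, Finset.sum_mul, word_cons]
  congr 1
  rw [Finset.sum_eq_single i]
  · rw [mul_assoc, hρ.star_T_mul, if_pos rfl]
  · intro j _ hj
    rw [mul_assoc, hρ.star_T_mul, if_neg hj]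
  · simp

theorem IsCuntz.star_V_mul_gen_mul_V (hρ : ρ.IsCuntz) (i j : Fin n) (u v : List (Fin n))
    (f : C₀(X, ℂ)) :
    star ρ.V * ρ.gen (i :: u) f (j :: v) * ρ.V = (n : ℂ)⁻¹ • ρ.gen u f v := by
  have h1 : star ρ.V * ρ.gen (i :: u) f (j :: v)
      = ((Real.sqrt n : ℂ)⁻¹) • ρ.gen u f (j :: v) := by
    rw [gen, ← mul_assoc, hρ.star_V_mul, smul_mul_assoc, gen]
  have h2 : ρ.gen u f (j :: v) * ρ.V = ((Real.sqrt n : ℂ)⁻¹) • ρ.gen u f v := by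
    have h3 := congrArg star (hρ.star_V_mul j v (star f))
    rw [star_mul, star_mul, star_star, star_smul, star_mul, ← map_star, star_star, star_inv₀] at h3
    have h4 : star (Real.sqrt n : ℂ) = Real.sqrt n := Complex.conj_ofReal _
    rw [h4] at h3
    rw [gen, mul_assoc (ρ.word u), mul_assoc, h3, mul_smul_comm, gen, mul_assoc]
  rw [h1, smul_mul_assoc, h2, smul_smul, inv_sqrt_mul_self]

/-- `V* V` acts as the identity next to `𝔅`: each of the `n²` terms of `α(t_u f t_v*)`, carrying
weight `1/n`, is compressed to `t_u f t_v* / n`. -/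
theorem IsCuntz.star_V_mul_α_mul_V (hρ : ρ.IsCuntz) {b : H →L[ℂ] H} (hb : b ∈ ρ.𝔅) :
    star ρ.V * ρ.α b * ρ.V = b := by
  have hcont : Continuous fun b => star ρ.V * ρ.α b * ρ.V :=
    (continuous_const.mul ρ.continuous_α).mul continuous_const
  have hcl : IsClosed {b : H →L[ℂ] H | star ρ.V * ρ.α b * ρ.V = b} :=
    isClosed_eq hcont continuous_id
  refine closure_minimal (fun x hx => ?_) hcl hb
  replace hx : x ∈ Submodule.span ℂ _ := hx
  change star ρ.V * ρ.α x * ρ.V = x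
  induction hx using Submodule.span_induction with
  | mem x hx =>
    obtain ⟨u, v, f, huv, rfl⟩ := hx
    change star ρ.V * ρ.α (ρ.gen u f v) * ρ.V = ρ.gen u f v
    -- For `n = 0` the Cuntz relation writes every generator as an empty sum.
    rcases Nat.eq_zero_or_pos n with rfl | hn
    · have h0 : ρ.gen u f v = 0 := by rw [hρ.gen_eq_sum, Finset.univ_eq_empty, Finset.sum_empty]
      rw [h0, α, mul_zero, zero_mul, mul_zero, zero_mul]
    · have hn' : (n : ℂ) ≠ 0 := Nat.cast_ne_zero.2 hn.ne'
      rw [α_gen, mul_smul_comm, smul_mul_assoc]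
      simp only [Finset.mul_sum, Finset.sum_mul, hρ.star_V_mul_gen_mul_V, Finset.sum_const,
        Finset.card_univ, Fintype.card_fin, ← Nat.cast_smul_eq_nsmul ℂ, smul_smul]
      rw [mul_inv_cancel₀ hn', mul_one, inv_mul_cancel₀ hn', one_smul]
  | zero => simp [α]
  | add x y _ _ hx hy =>
    conv_rhs => rw [← hx, ← hy]
    simp only [α, mul_add, add_mul]
  | smul c x _ hx =>
    conv_rhs => rw [← hx]
    simp only [α, mul_smul_comm, smul_mul_assoc]

theorem IsCuntz.isBiInvariantIdeal_closedSpan (hρ : ρ.IsCuntz) (hF : S.BiInvariant F) :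
    ρ.IsBiInvariantIdeal (ρ.closedSpan {f : C₀(X, ℂ) | ∀ x ∈ F, f x = 0}) where
  le := ρ.closedSpan_le (Submodule.isClosed_topologicalClosure _)
    fun u v f huv _ => ρ.gen_mem_𝔅 huv f
  closed := ρ.isClosed_closedSpan _
  mul_left b hb a ha := by
    rw [← closedSpan_univ] at hb
    refine hρ.mul_mem_closedSpan (I'' := {f : C₀(X, ℂ) | ∀ x ∈ F, f x = 0})
      (fun _ _ _ => Set.mem_univ _) (pull_mem_vanishing hF)
      (fun f _ g hg x hx => ?_) hb ha
    rw [ZeroAtInftyContinuousMap.mul_apply, hg x hx, mul_zero]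
  mul_right b hb a ha := by
    rw [← closedSpan_univ] at hb
    refine hρ.mul_mem_closedSpan (I'' := {f : C₀(X, ℂ) | ∀ x ∈ F, f x = 0})
      (pull_mem_vanishing hF) (fun _ _ _ => Set.mem_univ _)
      (fun f hf g _ x hx => ?_) ha hb
    rw [ZeroAtInftyContinuousMap.mul_apply, hf x hx, zero_mul]
  map_mem b hb := by
    let L : (H →L[ℂ] H) →ₗ[ℂ] (H →L[ℂ] H) :=
      LinearMap.mulRight ℂ (star ρ.V) ∘ₗ LinearMap.mulLeft ℂ ρ.V
    refine ρ.closedSpan_le (J := (ρ.closedSpan _).comap L)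
      ((ρ.isClosed_closedSpan _).preimage ρ.continuous_α) (fun u v f huv hf => ?_) hb
    change ρ.α (ρ.gen u f v) ∈ ρ.closedSpan _
    rw [α_gen]
    exact Submodule.smul_mem _ _ (Submodule.sum_mem _ fun i _ => Submodule.sum_mem _ fun j _ =>
      ρ.gen_mem_closedSpan (by simp [huv]) hf)
  mem_of_map_mem b hb hαb := by
    rw [← hρ.star_V_mul_α_mul_V hb]
    generalize ρ.α b = c at hαb
    rw [← SetLike.mem_coe, hρ.closedSpan_eq_closure (pull_mem_vanishing hF)] at hαb
    have hcont : Continuous fun c => star ρ.V * c * ρ.V :=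
      (continuous_const.mul continuous_id).mul continuous_const
    have h1 := map_mem_closure hcont hαb
      (t := ρ.closedSpan {f : C₀(X, ℂ) | ∀ x ∈ F, f x = 0}) ?_
    · rwa [(ρ.isClosed_closedSpan _).closure_eq] at h1
    intro x hx
    obtain ⟨k, hxk⟩ := Set.mem_iUnion.1 hx
    clear hx
    -- At level `k + 1` both words are nonempty, so `V*` and `V` each have a letter to remove.
    replace hxk := hρ.level_mono (pull_mem_vanishing hF) (Nat.le_succ k) hxk
    change star ρ.V * x * ρ.V ∈ ρ.closedSpan _
    induction hxk using Submodule.span_induction with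
    | mem x hx =>
      obtain ⟨u, v, f, hu, hv, hf, rfl⟩ := hx
      obtain ⟨i, u, rfl⟩ := List.exists_cons_of_length_eq_add_one hu
      obtain ⟨j, v, rfl⟩ := List.exists_cons_of_length_eq_add_one hv
      rw [hρ.star_V_mul_gen_mul_V]
      refine Submodule.smul_mem _ _ (ρ.gen_mem_closedSpan ?_ hf)
      simp only [List.length_cons, Nat.succ_eq_add_one, Nat.add_right_cancel_iff] at hu hv
      exact hu.trans hv.symm
    | zero => simp
    | add x y _ _ hx hy =>
      rw [mul_add, add_mul]
      exact Submodule.add_mem _ hx hy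
    | smul c x _ hx =>
      rw [mul_smul_comm, smul_mul_assoc]
      exact Submodule.smul_mem _ _ hx

end Converse

end RowContractiveRep

/-! ### The bijection for free surjective systems. -/

theorem ZeroAtInftyContinuousMap.eq_of_vanishing_iff {X : Type*} [TopologicalSpace X]
    [LocallyCompactSpace X] [T2Space X] {F G : Set X} (hF : IsClosed F) (hG : IsClosed G)
    (h : ∀ f : C₀(X, ℂ), (∀ x ∈ F, f x = 0) ↔ ∀ x ∈ G, f x = 0) : F = G := by
  have aux : ∀ {F G : Set X}, IsClosed G →
      (∀ f : C₀(X, ℂ), (∀ x ∈ G, f x = 0) → ∀ x ∈ F, f x = 0) → F ⊆ G := by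
    intro F G hG h x hx
    by_contra hcon
    obtain ⟨f, hf1, hf0⟩ := ZeroAtInftyContinuousMap.exists_apply_eq_one hG hcon
    exact one_ne_zero (hf1.symm.trans (h f hf0 x hx))
  exact (aux hG fun f => (h f).2).antisymm (aux hF fun f => (h f).1)

namespace RowContractiveRep

variable {n : ℕ} {X : Type u} [TopologicalSpace X] {S : MultiSystem n X}
variable {H : Type u} [NormedAddCommGroup H] [InnerProductSpace ℂ H] [CompleteSpace H]
variable {ρ : RowContractiveRep S H}

theorem IsCuntz.inter_range_eq_iff (hρ : ρ.IsCuntz) (J : Submodule ℂ (H →L[ℂ] H)) (F : Set X) :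
    (J : Set (H →L[ℂ] H)) ∩ Set.range ρ.π = ρ.π '' {f : C₀(X, ℂ) | ∀ x ∈ F, f x = 0} ↔
      ∀ f : C₀(X, ℂ), ρ.π f ∈ J ↔ ∀ x ∈ F, f x = 0 := by
  constructor
  · intro h f
    have h1 : ρ.π f ∈ (J : Set (H →L[ℂ] H)) ∩ Set.range ρ.π ↔ ρ.π f ∈ J :=
      ⟨fun h => h.1, fun h => ⟨h, f, rfl⟩⟩
    rw [← h1, h, hρ.π_injective.mem_set_image]
    rfl
  · intro h
    ext b
    constructor
    · rintro ⟨hb, f, rfl⟩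
      exact ⟨f, (h f).1 hb, rfl⟩
    · rintro ⟨f, hf, rfl⟩
      exact ⟨(h f).2 hf, f, rfl⟩

/-- The bijection between bi-invariant ideals and closed bi-invariant sets, for a free surjective
system. -/
theorem IsCuntz.exists_bijective [LocallyCompactSpace X] [T2Space X] (hρ : ρ.IsCuntz)
    (hS : S.IsFree) (hsurj : S.IsSurjective) :
    ∃ Φ : {J : Submodule ℂ (H →L[ℂ] H) // ρ.IsBiInvariantIdeal J} →
        {F : Set X // IsClosed F ∧ S.BiInvariant F},
      Function.Bijective Φ ∧
        ∀ J F, Φ J = F ↔ (J.1 : Set (H →L[ℂ] H)) ∩ Set.range ρ.π =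
          ρ.π '' {f : C₀(X, ℂ) | ∀ x ∈ F.1, f x = 0} := by
  let Φ : {J : Submodule ℂ (H →L[ℂ] H) // ρ.IsBiInvariantIdeal J} →
      {F : Set X // IsClosed F ∧ S.BiInvariant F} := fun J =>
    ⟨ρ.hull J.1, ρ.isClosed_hull J.1, hρ.biInvariant_hull hS J.2⟩
  have hΦ : ∀ J F, Φ J = F ↔ ∀ f : C₀(X, ℂ), ρ.π f ∈ J.1 ↔ ∀ x ∈ F.1, f x = 0 := by
    intro J F
    constructor
    · rintro rfl f
      exact J.2.toIsIdeal.π_mem_iff f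
    · intro h
      refine Subtype.ext (ZeroAtInftyContinuousMap.eq_of_vanishing_iff (Φ J).2.1 F.2.1 fun f => ?_)
      rw [← h f]
      exact (J.2.toIsIdeal.π_mem_iff f).symm
  refine ⟨Φ, ⟨fun J J' h => ?_, fun F => ?_⟩, fun J F => ?_⟩
  · have h1 := (hΦ J (Φ J')).1 h
    have h2 := (hΦ J' (Φ J')).1 rfl
    refine Subtype.ext ?_
    -- Injectivity: each ideal is recovered from the functions it contains.
    rw [← hρ.closedSpan_eq J.2, ← hρ.closedSpan_eq J'.2]
    congr 1
    ext f
    exact (h1 f).trans (h2 f).symm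
  · exact ⟨⟨_, hρ.isBiInvariantIdeal_closedSpan F.2.2⟩,
      (hΦ _ F).2 (hρ.π_mem_closedSpan_iff hsurj F.2.2)⟩
  · rw [hρ.inter_range_eq_iff]
    exact hΦ J F

end RowContractiveRep

/-! ### Freeness, surjectivity and local compactness of the covering system. -/

namespace MultiSystem

variable {n : ℕ} {X : Type u} [TopologicalSpace X]

theorem covering_isFree (S : MultiSystem n X) : S.covering.IsFree := by
  intro i j x y h
  have h1 : (S.tailMap i x).1 = (S.tailMap j y).1 := congrArg Subtype.val h
  refine ⟨congrFun (congrArg Prod.fst h1) 0, Subtype.ext (Prod.ext ?_ ?_)⟩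
  · funext k
    exact congrFun (congrArg Prod.fst h1) (k + 1)
  · funext k
    exact congrFun (congrArg Prod.snd h1) (k + 1)

theorem covering_isSurjective (S : MultiSystem n X) : S.covering.IsSurjective := by
  intro z
  refine ⟨z.1.1 0, ⟨(fun k => z.1.1 (k + 1), fun k => z.1.2 (k + 1)), fun k => z.2 (k + 1)⟩,
    Subtype.ext (Prod.ext ?_ ?_)⟩
  · funext k
    cases k with
    | zero => rfl
    | succ k => rfl
  · funext k
    cases k with
    | zero => exact z.2 0
    | succ k => rfl

instance (S : MultiSystem n X) [T2Space X] : T2Space S.Tail :=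
  inferInstanceAs (T2Space
    {z : (ℕ → Fin n) × (ℕ → X) // ∀ k, S.map (z.1 k) (z.2 (k + 1)) = z.2 k})

/-- The points that reach `K` after `k` steps. -/
def iteratedPreimage (S : MultiSystem n X) (K : Set X) : ℕ → Set X
  | 0 => K
  | k + 1 => ⋃ i, S.map i ⁻¹' S.iteratedPreimage K k

theorem isCompact_iteratedPreimage (S : MultiSystem n X) {K : Set X} (hK : IsCompact K) (k : ℕ) :
    IsCompact (S.iteratedPreimage K k) := by
  induction k with
  | zero => exact hK
  | succ k ih => exact isCompact_iUnion fun i => (S.proper i).isCompact_preimage ih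

/-- If `x_0 ∈ K`, then `x_k` lies in the `k`-fold preimage of `K`, compact by properness. The set is
thus closed in a Tychonoff product of compact sets, and such sets are the compact neighbourhoods in
the tail space. -/
theorem isCompact_tail [T2Space X] (S : MultiSystem n X) {K : Set X} (hK : IsCompact K) :
    IsCompact {z : S.Tail | z.1.2 0 ∈ K} := by
  have hcl : IsClosed {z : (ℕ → Fin n) × (ℕ → X) |
      ∀ k, S.map (z.1 k) (z.2 (k + 1)) = z.2 k} := by
    have : {z : (ℕ → Fin n) × (ℕ → X) | ∀ k, S.map (z.1 k) (z.2 (k + 1)) = z.2 k}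
        -- The map in the condition depends on the point. Splitting over the value `i` of the
        -- discrete coordinate leaves closed conditions with a fixed map.
        = ⋂ k, ⋂ i, {z | z.1 k = i}ᶜ ∪ {z | S.map i (z.2 (k + 1)) = z.2 k} := by
      ext z
      simp only [Set.mem_ofPred_eq, Set.mem_iInter, Set.mem_union, Set.mem_compl_iff]
      constructor
      · intro h k i
        by_cases hi : z.1 k = i
        · exact Or.inr (hi ▸ h k)
        · exact Or.inl hi
      · intro h k
        exact (h k (z.1 k)).resolve_left fun h' => h' rfl
    rw [this]
    refine isClosed_iInter fun k => isClosed_iInter fun i => IsClosed.union ?_ ?_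
    · rw [isClosed_compl_iff]
      have hk : Continuous fun z : (ℕ → Fin n) × (ℕ → X) => z.1 k :=
        (continuous_apply k).comp continuous_fst
      exact (isOpen_discrete ({i} : Set (Fin n))).preimage hk
    · exact isClosed_eq ((S.proper i).continuous.comp ((continuous_apply (k + 1)).comp
        continuous_snd)) ((continuous_apply k).comp continuous_snd)
  have hC : IsCompact ((Set.univ : Set (ℕ → Fin n)) ×ˢ
      Set.univ.pi fun k => S.iteratedPreimage K k) :=
    isCompact_univ.prod (isCompact_univ_pi fun k => S.isCompact_iteratedPreimage hK k)
  have hemb : Topology.IsClosedEmbedding (Subtype.val : S.Tail → (ℕ → Fin n) × (ℕ → X)) :=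
    hcl.isClosedEmbedding_subtypeVal
  have heq : {z : S.Tail | z.1.2 0 ∈ K} = Subtype.val ⁻¹' ((Set.univ : Set (ℕ → Fin n)) ×ˢ
      Set.univ.pi fun k => S.iteratedPreimage K k) := by
    ext z
    constructor
    · intro h
      refine ⟨Set.mem_univ _, fun k _ => ?_⟩
      induction k with
      | zero => exact h
      | succ k ih =>
        refine Set.mem_iUnion.2 ⟨z.1.1 k, ?_⟩
        rw [Set.mem_preimage, z.2 k]
        exact ih (Set.mem_univ _)
    · intro h
      exact h.2 0 (Set.mem_univ _)
  rw [heq]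
  exact hemb.isCompact_preimage hC

instance (S : MultiSystem n X) [LocallyCompactSpace X] [T2Space X] :
    LocallyCompactSpace S.Tail := by
  have : WeaklyLocallyCompactSpace S.Tail := by
    refine ⟨fun z => ?_⟩
    obtain ⟨K, hK, hmem⟩ := exists_compact_mem_nhds (z.1.2 0)
    have hc : Continuous fun z : S.Tail => z.1.2 0 :=
      (continuous_apply 0).comp (continuous_snd.comp continuous_subtype_val)
    exact ⟨_, S.isCompact_tail hK, hc.continuousAt hmem⟩
  infer_instance

end MultiSystem

theorem corollaryC {n : ℕ} {X : Type u} [TopologicalSpace X] [LocallyCompactSpace X] [T2Space X]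
    (S : MultiSystem n X) (hS : S.IsSurjective)
    {K : Type u} [NormedAddCommGroup K] [InnerProductSpace ℂ K] [CompleteSpace K]
    (ρ : RowContractiveRep S.covering K) (hρ : ρ.IsCStarEnvelope) :
    ∃ Φ : {J : Submodule ℂ (K →L[ℂ] K) // ρ.IsBiInvariantIdeal J} →
        {F : Set S.Tail // IsClosed F ∧ S.covering.BiInvariant F},
      Function.Bijective Φ ∧
        ∀ J F, Φ J = F ↔ (J.1 : Set (K →L[ℂ] K)) ∩ Set.range ρ.π =
          ρ.π '' {f : C₀(S.Tail, ℂ) | ∀ x ∈ F.1, f x = 0} := by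
  exact (hρ.isCuntz S.covering_isFree S.covering_isSurjective).exists_bijective S.covering_isFree
    S.covering_isSurjective
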